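/- For $K \ge 1$, a homeomorphism $\phi : \mathbb{C} \to \mathbb{C}$ is called $K$-quasiconformal if it is orientation preserving, belongs to $W^{1,2}_{loc}(\mathbb{C})$ and satisfies $\max_\alpha |\partial_\alpha \phi| \le K \min_\alpha |\partial_\alpha \phi|$ almost everywhere, where $\partial_\alpha$ is the derivative in the direction $e^{i\alpha}$. A gauge function is a continuous non-decreasing function $g : [0,\infty) \to [0,\infty)$ with $\lim_{t \to 0} g(t) = 0$ and $g(t) > 0$ for $t > 0$; the associated Hausdorff measure is $$\mathcal{H}^g(F) = \lim_{\delta \to 0} \, \inf \Big\{ \sum_j g(2 r_j) : F \subset \bigcup_j B(z_j, r_j), \ 2 r_j < \delta \Big\},$$ the infimum being over countable coverings of $F \subset \mathbb{C}$ by disks. $\mathcal{H}^s$ denotes the usual $s$-dimensional Hausdorff measure. Corollary 3.4. Let $K \ge 1$, $0 < d < 2$ and $d' = \frac{2Kd}{2+(K-1)d}$. Then there exist a compact set $E \subset \mathbb{C}$ and a $K$-quasiconformal mapping $\phi : \mathbb{C} \to \mathbb{C}$ such that $$0 < \mathcal{H}^d(E) < \infty \quad\text{and}\quad 0 < \mathcal{H}^{d'}(\phi(E))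 < \infty .$$ Moreover, the hypothesis of the implication $$\mathcal{H}^d(E) = 0 \implies \mathcal{H}^{d'}(\phi(E)) = 0 \qquad (E \text{ compact}, \ \phi : \mathbb{C} \to \mathbb{C} \ K\text{-quasiconformal})$$ is sharp, in the sense that no relaxation of it in terms of gauge functions allows the same conclusion: for every gauge function $g$ with $g(t)/t^d \to 0$ as $t \to 0^+$, it is not true that $\mathcal{H}^g(E) = 0$ implies $\mathcal{H}^{d'}(\phi(E)) = 0$ for all compact sets $E \subset \mathbb{C}$ and all $K$-quasiconformal mappings $\phi : \mathbb{C} \to \mathbb{C}$. -/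

import Mathlib

open Set Filter Topology MeasureTheory
open scoped ENNReal ContDiff

noncomputable section

/-- `g` is a weak partial derivative of `f : ℂ → ℂ` in the direction `v ∈ ℂ = ℝ²`, on the whole
plane: `∫ (∂_v ψ) f = - ∫ ψ g` for every real test function `ψ ∈ C_c^∞(ℂ)`. -/
def IsWeakPartial (v : ℂ) (f g : ℂ → ℂ) : Prop :=
  ∀ ψ : ℂ → ℝ, ContDiff ℝ ∞ ψ → HasCompactSupport ψ →
    ∫ z, (fderiv ℝ ψ z v) • f z = - ∫ z, ψ z • g z

/-- `f ∈ L²_loc(ℂ)`. -/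
def IsL2Loc (f : ℂ → ℂ) : Prop :=
  ∀ C : Set ℂ, IsCompact C → MemLp f 2 (volume.restrict C)

/-- `φ : ℂ → ℂ` is a `K`-quasiconformal mapping of the plane: an orientation preserving
homeomorphism of class `W^{1,2}_loc(ℂ)` with `max_α |∂_α φ| ≤ K min_α |∂_α φ|` almost everywhere.

Here `p` and `q` are the weak partial derivatives `∂_x φ` and `∂_y φ`, which are unique almost
everywhere, `∂_α φ = cos α ∂_x φ + sin α ∂_y φ` is the derivative in the direction `e^{iα}`, and
"orientation preserving" is expressed, as usual for Sobolev homeomorphisms, by the Jacobian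
`J_φ = Re (∂_x φ) Im (∂_y φ) - Im (∂_x φ) Re (∂_y φ)` being nonnegative almost everywhere. -/
def IsQuasiconformal (K : ℝ) (φ : ℂ → ℂ) : Prop :=
  IsHomeomorph φ ∧ IsL2Loc φ ∧
    ∃ p q : ℂ → ℂ, IsWeakPartial 1 φ p ∧ IsWeakPartial Complex.I φ q ∧ IsL2Loc p ∧ IsL2Loc q ∧
      (∀ᵐ z : ℂ, ∀ α β : ℝ,
        ‖(Real.cos α : ℂ) * p z + (Real.sin α : ℂ) * q z‖ ≤
          K * ‖(Real.cos β : ℂ) * p z + (Real.sin β : ℂ) * q z‖) ∧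
      (∀ᵐ z : ℂ, 0 ≤ (p z).re * (q z).im - (p z).im * (q z).re)

/-- A gauge function (measure function): continuous and non-decreasing on `[0, ∞)`,
tending to `0` at `0`, and positive on `(0, ∞)`. Only the values on `[0, ∞)` matter. -/
structure IsGauge (h : ℝ → ℝ) : Prop where
  continuousOn : ContinuousOn h (Ici 0)
  monotoneOn : MonotoneOn h (Ici 0)
  tendsto_zero : Tendsto h (𝓝[>] 0) (𝓝 0)
  pos : ∀ t, 0 < t → 0 < h t

/-- The partial order `g ≺ h` on gauge functions: `h(t) / g(t) → 0` as `t → 0⁺`. -/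
def GaugePrec (g h : ℝ → ℝ) : Prop :=
  Tendsto (fun t => h t / g t) (𝓝[>] 0) (𝓝 0)

/-- The generalized Hausdorff measure `H^h(F)` of `F ⊆ ℂ` for a gauge function `h`: the limit
(supremum) as `δ → 0` of the infimum of `∑ h (2 r_j)` over all countable coverings of `F` by disks
`B(z_j, r_j)` of diameter `2 r_j < δ`. Finite coverings are included, as `B(z, 0)` is empty and
`h 0 = 0`. -/
def gaugeHausdorff (h : ℝ → ℝ) (F : Set ℂ) : ℝ≥0∞ :=
  ⨆ (δ : ℝ) (_ : 0 < δ),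
    ⨅ (z : ℕ → ℂ) (r : ℕ → ℝ) (_ : ∀ j, 0 ≤ r j ∧ 2 * r j < δ)
      (_ : F ⊆ ⋃ j, Metric.ball (z j) (r j)),
      ∑' j, ENNReal.ofReal (h (2 * r j))

/-- For the gauge `t ^ a` the disk definition is comparable with Mathlib's Hausdorff measure
`μH[a]`: lower bound. -/
theorem hausdorffMeasure_le_gaugeHausdorff (a : ℝ) (ha : 0 < a) (F : Set ℂ) :
    μH[a] F ≤ gaugeHausdorff (fun t => t ^ a) F := by
  rw [Measure.hausdorffMeasure_apply]
  refine iSup₂_le fun ρ hρ => ?_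
  obtain ⟨δ, hδ, hδρ⟩ : ∃ δ : ℝ, 0 < δ ∧ ENNReal.ofReal δ ≤ ρ := by
    rcases eq_or_ne ρ ⊤ with rfl | h
    · exact ⟨1, one_pos, le_top⟩
    · exact ⟨ρ.toReal, ENNReal.toReal_pos hρ.ne' h, ENNReal.ofReal_toReal_le⟩
  refine le_trans ?_ (le_iSup₂ (α := ℝ≥0∞) δ hδ)
  refine le_iInf fun z => le_iInf fun r => le_iInf fun hr => le_iInf fun hF => ?_
  have hd : ∀ j, Metric.ediam (Metric.ball (z j) (r j)) ≤ ENNReal.ofReal (2 * r j) := by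
    intro j
    refine Metric.ediam_le fun x hx y hy => ?_
    rw [edist_dist]
    refine ENNReal.ofReal_le_ofReal ?_
    have h1 := dist_triangle_right x y (z j)
    have h2 := Metric.mem_ball.1 hx
    have h3 := Metric.mem_ball.1 hy
    linarith
  refine iInf_le_of_le (fun j => Metric.ball (z j) (r j)) (iInf_le_of_le hF
    (iInf_le_of_le (fun j => ((hd j).trans (ENNReal.ofReal_le_ofReal (hr j).2.le)).trans hδρ) ?_))
  refine ENNReal.tsum_le_tsum fun j => iSup_le fun _ => ?_
  rw [← ENNReal.ofReal_rpow_of_nonneg (by linarith [(hr j).1]) ha.le]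
  exact ENNReal.rpow_le_rpow (hd j) ha.le

/-- For the gauge `t ^ a` the disk definition is comparable with Mathlib's Hausdorff measure
`μH[a]`: upper bound. -/
theorem gaugeHausdorff_le_hausdorffMeasure (a : ℝ) (ha : 0 < a) (F : Set ℂ) :
    gaugeHausdorff (fun t => t ^ a) F ≤ 2 ^ a * μH[a] F := by
  refine iSup₂_le fun δ hδ => ?_
  rw [Measure.hausdorffMeasure_apply]
  refine le_trans ?_ (mul_le_mul_right (le_iSup₂ (α := ℝ≥0∞)
    (ENNReal.ofReal (δ / 4)) (ENNReal.ofReal_pos.2 (by linarith))) _)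
  have h2 : (2 : ℝ≥0∞) ^ a ≠ ⊤ := ENNReal.rpow_ne_top_of_nonneg ha.le (by simp)
  simp only [ENNReal.mul_iInf_of_ne (by simp : (2 : ℝ≥0∞) ^ a ≠ 0) h2]
  refine le_iInf fun t => le_iInf fun hF => le_iInf fun ht => ?_
  refine ENNReal.le_of_forall_pos_le_add fun ε hε _ => ?_
  obtain ⟨e, he, hes⟩ := ENNReal.exists_pos_sum_of_countable (ENNReal.coe_pos.2 hε).ne' ℕ
  have key : ∀ j, ∃ (z : ℂ) (r : ℝ), (0 ≤ r ∧ 2 * r < δ) ∧ t j ⊆ Metric.ball z r ∧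
      ENNReal.ofReal ((2 * r) ^ a) ≤
        2 ^ a * (⨆ _ : (t j).Nonempty, Metric.ediam (t j) ^ a) + e j := by
    intro j
    rcases (t j).eq_empty_or_nonempty with h | ⟨x, hx⟩
    · exact ⟨0, 0, ⟨le_rfl, by simpa using hδ⟩, by simp [h], by simp [Real.zero_rpow ha.ne']⟩
    have hfin : Metric.ediam (t j) ≠ ⊤ := ((ht j).trans_lt ENNReal.ofReal_lt_top).ne
    set s : ℝ := (Metric.ediam (t j)).toReal with hs
    have hs0 : 0 ≤ s := ENNReal.toReal_nonneg
    have hsd : s ≤ δ / 4 := ENNReal.toReal_le_of_le_ofReal (by linarith) (ht j)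
    have hes' : ENNReal.ofReal s = Metric.ediam (t j) := ENNReal.ofReal_toReal hfin
    have hc : ContinuousAt (fun r : ℝ => (2 * r) ^ a) s :=
      ((continuous_const.mul continuous_id).continuousAt).rpow_const (Or.inr ha.le)
    have hev : ∀ᶠ r in 𝓝[>] s, (2 * r) ^ a < (2 * s) ^ a + (e j : ℝ) ∧ r < δ / 2 ∧ s < r := by
      have h1 : ∀ᶠ r in 𝓝 s, (2 * r) ^ a < (2 * s) ^ a + (e j : ℝ) :=
        hc.eventually_lt_const (lt_add_of_pos_right _ (NNReal.coe_pos.2 (he j)))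
      have h3 : ∀ᶠ r in 𝓝 s, r < δ / 2 := eventually_lt_nhds (by linarith)
      filter_upwards [h1.filter_mono nhdsWithin_le_nhds, h3.filter_mono nhdsWithin_le_nhds,
        self_mem_nhdsWithin] with r u v w
      exact ⟨u, v, w⟩
    obtain ⟨r, hr1, hr2, hr3⟩ := hev.exists
    refine ⟨x, r, ⟨by linarith, by linarith⟩, fun y hy => ?_, ?_⟩
    · rw [Metric.mem_ball]
      refine lt_of_le_of_lt ?_ hr3
      rw [hs, dist_edist]
      exact ENNReal.toReal_mono hfin (Metric.edist_le_ediam_of_mem hy hx)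
    · rw [ciSup_pos ⟨x, hx⟩, ← hes', ENNReal.ofReal_rpow_of_nonneg hs0 ha.le]
      have e2 : (2 : ℝ≥0∞) ^ a = ENNReal.ofReal ((2 : ℝ) ^ a) := by
        rw [← ENNReal.ofReal_rpow_of_nonneg zero_le_two ha.le]; simp
      rw [e2, ← ENNReal.ofReal_mul (by positivity), ← Real.mul_rpow zero_le_two hs0,
        ← ENNReal.ofReal_coe_nnreal, ← ENNReal.ofReal_add (by positivity) (NNReal.coe_nonneg _)]
      exact ENNReal.ofReal_le_ofReal hr1.le
  choose z r hr hsub hle using key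
  refine iInf_le_of_le z (iInf_le_of_le r (iInf_le_of_le hr (iInf_le_of_le
    (hF.trans (iUnion_mono hsub)) ?_)))
  calc ∑' j, ENNReal.ofReal ((2 * r j) ^ a)
      ≤ ∑' j, (2 ^ a * (⨆ _ : (t j).Nonempty, Metric.ediam (t j) ^ a) + e j) :=
        ENNReal.tsum_le_tsum hle
    _ = 2 ^ a * ∑' j, (⨆ _ : (t j).Nonempty, Metric.ediam (t j) ^ a) + ∑' j, (e j : ℝ≥0∞) := by
        rw [ENNReal.tsum_add, ENNReal.tsum_mul_left]
    _ ≤ _ := by gcongr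

end

/-! Write d = 2/a with a > 1. At level k, pack the unit disk by finitely many disjoint disks whose
radii R satisfy ∑ R² ≥ 1 - 1/(k+2)². Iterating these packings, with the centres kept but every R
replaced by R^a, produces the Cantor set `packingCantor P a`. Because (R^a)^(2/a) = R² and ∑ R² ≤ 1,
its natural covers have bounded 2/a-dimensional mass, so its measure is finite. For the lower bound
compare with exponent 1: that set has positive area, since the packed fractions have a positive
infinite product, and matching points of equal address is Hölder of exponent 1/a from the a-set to
the 1-set (`norm_sub_le_of_mem_addressPairs`). Hence the 2/a-measure of the a-set is positive.

The power map of radial exponent 1/K on the annulus R^a ≤ |z| ≤ R has distortion K and shrinks or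
expands the inner circle to radius R^b, where b = 1 + (a-1)/K. Nesting such annuli inside the
packing disks gives maps converging uniformly to a homeomorphism that carries the a-set to the b-set
(`cantorMap_image_packingCantor`), and 2/b is exactly d'.

The limit is K-quasiconformal by a direct argument. Off the Cantor set, which is null, it agrees
locally with a Lipschitz approximant of distortion at most K. The energy bound ∫_A |∂f|² ≤ K |f(A)|,
together with the vanishing area of the stages, lets weak derivatives pass to the limit
(`IsWeakPartial.of_tendstoUniformly`).

Sharpness for gauges follows from the same pair: if g(t)/t^d → 0, finiteness of the d-measure of E
forces its g-measure to vanish, while the image still has positive d'-measure. -/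

open scoped Pointwise

/-! ### Packings of the unit disk -/

/-- A finite family of pairwise disjoint closed disks `(c, R)` in the closed unit disk. -/
structure DiskPacking where
  disks : Finset (ℂ × ℝ)
  pos : ∀ p ∈ disks, 0 < p.2
  le_half : ∀ p ∈ disks, p.2 ≤ 1 / 2
  norm_add_le : ∀ p ∈ disks, ‖p.1‖ + p.2 ≤ 1
  add_lt_norm : ∀ p ∈ disks, ∀ q ∈ disks, p ≠ q → p.2 + q.2 < ‖p.1 - q.1‖

namespace DiskPacking

theorem pairwiseDisjoint (P : DiskPacking) :
    (P.disks : Set (ℂ × ℝ)).PairwiseDisjoint fun p => Metric.closedBall p.1 p.2 := by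
  intro p hp q hq hpq
  refine Metric.closedBall_disjoint_closedBall ?_
  rw [dist_eq_norm]
  exact P.add_lt_norm p hp q hq hpq

theorem closedBall_subset (P : DiskPacking) {p : ℂ × ℝ} (hp : p ∈ P.disks) :
    Metric.closedBall p.1 p.2 ⊆ Metric.closedBall 0 1 := by
  refine Metric.closedBall_subset_closedBall' ?_
  have := P.norm_add_le p hp
  rw [dist_zero_right]
  linarith

theorem sum_sq_le_one (P : DiskPacking) : ∑ p ∈ P.disks, p.2 ^ 2 ≤ 1 := by
  have h1 : volume (⋃ p ∈ P.disks, Metric.closedBall p.1 p.2) ≤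
      volume (Metric.closedBall (0 : ℂ) 1) :=
    measure_mono (iUnion₂_subset fun p hp => P.closedBall_subset hp)
  rw [measure_biUnion_finset P.pairwiseDisjoint fun _ _ => measurableSet_closedBall] at h1
  simp only [Complex.volume_closedBall, ← Finset.sum_mul, ENNReal.ofReal_one, one_pow] at h1
  rw [ENNReal.mul_le_mul_iff_left (by simpa using NNReal.pi_ne_zero) (by simp)] at h1
  have h2 : ∑ p ∈ P.disks, ENNReal.ofReal p.2 ^ 2 = ENNReal.ofReal (∑ p ∈ P.disks, p.2 ^ 2) := by
    rw [ENNReal.ofReal_sum_of_nonneg fun _ _ => sq_nonneg _]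
    exact Finset.sum_congr rfl fun p hp => (ENNReal.ofReal_pow (P.pos p hp).le 2).symm
  rw [h2] at h1
  simpa using h1

/-- The unit disk can be packed by finitely many small disks up to arbitrarily small area. -/
theorem exists_packing {δ ε : ℝ} (hδ : 0 < δ) (hδ2 : δ ≤ 1 / 2) (hε : 0 < ε) :
    ∃ P : DiskPacking, (∀ p ∈ P.disks, p.2 ≤ δ) ∧ 1 - ε ≤ ∑ p ∈ P.disks, p.2 ^ 2 := by
  classical
  obtain ⟨t, r, htc, hts, htr, hcov, hdisj⟩ :=
    Besicovitch.exists_disjoint_closedBall_covering_ae (volume : Measure ℂ) (fun _ => univ)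
      (Metric.ball 0 1)
      (fun x _ δ hδ => ⟨δ / 2, trivial, half_pos hδ, half_lt_self hδ⟩)
      -- This cap on the radius at x keeps the closed ball inside the unit disk and its radius below
      -- δ.
      (fun x => min (1 - ‖x‖) δ)
      (fun x hx => lt_min (by simpa using hx) hδ)
  have hr0 : ∀ x ∈ t, 0 < r x := fun x hx => (htr x hx).2.1
  have hr1 : ∀ x ∈ t, r x < 1 - ‖x‖ := fun x hx => (htr x hx).2.2.trans_le (min_le_left _ _)
  have hr2 : ∀ x ∈ t, r x < δ := fun x hx => (htr x hx).2.2.trans_le (min_le_right _ _)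
  have hvol : volume (Metric.ball (0 : ℂ) 1) ≤
      ∑' x : t, volume (Metric.closedBall (x : ℂ) (r x)) := by
    rw [← measure_biUnion htc hdisj fun _ _ => measurableSet_closedBall]
    exact (measure_mono_ae (ae_le_set.2 hcov))
  simp only [Complex.volume_closedBall, Complex.volume_ball, ENNReal.tsum_mul_right] at hvol
  rw [ENNReal.mul_le_mul_iff_left (by simpa using NNReal.pi_ne_zero) (by simp)] at hvol
  -- The balls cover almost everything, so ∑ r² ≥ 1; some finite partial sum already exceeds 1 - ε.
  have hlt : ENNReal.ofReal (1 - ε) < ∑' x : t, ENNReal.ofReal (r x) ^ 2 := by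
    refine lt_of_lt_of_le ?_ hvol
    simp only [ENNReal.ofReal_one, one_pow]
    rw [← ENNReal.ofReal_one]
    exact (ENNReal.ofReal_lt_ofReal_iff one_pos).2 (by linarith)
  rw [ENNReal.tsum_eq_iSup_sum, lt_iSup_iff] at hlt
  obtain ⟨s, hs⟩ := hlt
  refine ⟨⟨s.image fun x : t => ((x : ℂ), r x), ?_, ?_, ?_, ?_⟩, ?_, ?_⟩
  · simp only [Finset.mem_image]
    rintro p ⟨x, -, rfl⟩
    exact hr0 x x.2
  · simp only [Finset.mem_image]
    rintro p ⟨x, -, rfl⟩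
    exact (hr2 x x.2).le.trans hδ2
  · simp only [Finset.mem_image]
    rintro p ⟨x, -, rfl⟩
    have := hr1 x x.2
    simp only
    linarith
  · simp only [Finset.mem_image]
    rintro p ⟨x, -, rfl⟩ q ⟨y, -, rfl⟩ hxy
    have hne : (x : ℂ) ≠ y := fun h => hxy (by rw [Subtype.ext h])
    have := hdisj x.2 y.2 hne
    rw [Function.onFun, disjoint_closedBall_closedBall_iff (hr0 x x.2).le (hr0 y y.2).le,
      dist_eq_norm] at this
    exact this
  · simp only [Finset.mem_image]
    rintro p ⟨x, -, rfl⟩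
    exact (hr2 x x.2).le
  · simp only
    rw [Finset.sum_image fun x _ y _ h => Subtype.ext (congrArg Prod.fst h)]
    simp only
    have : ∑ x ∈ s, ENNReal.ofReal (r x) ^ 2 = ENNReal.ofReal (∑ x ∈ s, r x ^ 2) := by
      rw [ENNReal.ofReal_sum_of_nonneg fun _ _ => sq_nonneg _]
      exact Finset.sum_congr rfl fun x _ => (ENNReal.ofReal_pow (hr0 x x.2).le 2).symm
    rw [this] at hs
    exact (ENNReal.ofReal_lt_ofReal_iff'.1 hs).1.le

end DiskPacking

/-! ### Cantor sets from packings, and finiteness of their measure -/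

/-- The `N`-th stage of the Cantor construction in which, at level `k`, each disk is replaced by
scaled copies of the disks of `P k` whose radii `R` are replaced by `R ^ a`. -/
noncomputable def cantorStage (P : ℕ → DiskPacking) (a : ℝ) : ℕ → ℕ → Set ℂ
  | 0, _ => Metric.closedBall 0 1
  | N + 1, k => ⋃ p ∈ (P k).disks,
      (fun z : ℂ => p.1 + (p.2 ^ a : ℝ) • z) '' cantorStage P a N (k + 1)

theorem isCompact_cantorStage (P : ℕ → DiskPacking) (a : ℝ) (N k : ℕ) :
    IsCompact (cantorStage P a N k) := by
  induction N generalizing k with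
  | zero => exact isCompact_closedBall _ _
  | succ N ih =>
    exact (P k).disks.isCompact_biUnion fun p _ => (ih (k + 1)).image (by fun_prop)

theorem DiskPacking.rpow_le (P : DiskPacking) {a : ℝ} (ha : 1 ≤ a) {p : ℂ × ℝ}
    (hp : p ∈ P.disks) : p.2 ^ a ≤ p.2 := by
  have h := Real.rpow_le_rpow_of_exponent_ge (P.pos p hp)
    ((P.le_half p hp).trans (by norm_num)) ha
  rwa [Real.rpow_one] at h

theorem cantorStage_subset_closedBall (P : ℕ → DiskPacking) {a : ℝ} (ha : 1 ≤ a) (N k : ℕ) :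
    cantorStage P a N k ⊆ Metric.closedBall 0 1 := by
  induction N generalizing k with
  | zero => exact subset_rfl
  | succ N ih =>
    refine iUnion₂_subset fun p hp => ?_
    rintro _ ⟨z, hz, rfl⟩
    have h1 : ‖z‖ ≤ 1 := by simpa using ih (k + 1) hz
    have h2 := (P k).rpow_le ha hp
    have h3 := Real.rpow_nonneg ((P k).pos p hp).le a
    have h4 := (P k).norm_add_le p hp
    rw [mem_closedBall_zero_iff]
    calc ‖p.1 + (p.2 ^ a : ℝ) • z‖ ≤ ‖p.1‖ + p.2 ^ a * ‖z‖ := by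
          refine (norm_add_le _ _).trans ?_
          rw [norm_smul, Real.norm_of_nonneg h3]
      _ ≤ 1 := by nlinarith [norm_nonneg z]

theorem cantorStage_succ_subset (P : ℕ → DiskPacking) {a : ℝ} (ha : 1 ≤ a) (N k : ℕ) :
    cantorStage P a (N + 1) k ⊆ cantorStage P a N k := by
  induction N generalizing k with
  | zero => exact cantorStage_subset_closedBall P ha 1 k
  | succ N ih => exact iUnion₂_mono fun p _ => image_mono (ih (k + 1))

theorem antitone_cantorStage (P : ℕ → DiskPacking) {a : ℝ} (ha : 1 ≤ a) (k : ℕ) :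
    Antitone fun N => cantorStage P a N k :=
  antitone_nat_of_succ_le fun N => cantorStage_succ_subset P ha N k

/-- The Cantor set which is the intersection of all stages. -/
def packingCantor (P : ℕ → DiskPacking) (a : ℝ) : Set ℂ := ⋂ N, cantorStage P a N 0

theorem isCompact_packingCantor (P : ℕ → DiskPacking) (a : ℝ) : IsCompact (packingCantor P a) :=
  (isCompact_cantorStage P a 0 0).of_isClosed_subset
    (isClosed_iInter fun N => (isCompact_cantorStage P a N 0).isClosed) (iInter_subset _ 0)

/-- The exponent 2/a undoes the power a: (R^a)^(2/a) = R². The mass of the cover is therefore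
multiplied at each level by ∑ R² ≤ 1, whatever a is, while radii at most 1/2 make the mesh decay
geometrically. -/
theorem exists_cover_cantorStage (P : ℕ → DiskPacking) {a : ℝ} (ha : 1 ≤ a) (N k : ℕ) :
    ∃ (ι : Type) (_ : Fintype ι) (c : ι → ℂ) (ρ : ι → ℝ), (∀ i, 0 ≤ ρ i ∧ ρ i ≤ (1 / 2) ^ N) ∧
      cantorStage P a N k ⊆ ⋃ i, Metric.closedBall (c i) (ρ i) ∧ ∑ i, ρ i ^ (2 / a) ≤ 1 := by
  induction N generalizing k with
  | zero =>
    exact ⟨Unit, inferInstance, fun _ => 0, fun _ => 1, by simp,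
      (subset_iUnion (fun _ : Unit => Metric.closedBall (0 : ℂ) 1) ()), by simp⟩
  | succ N ih =>
    obtain ⟨ι, _, c, ρ, hρ, hc, hs⟩ := ih (k + 1)
    refine ⟨(P k).disks × ι, inferInstance, fun i => i.1.1.1 + (i.1.1.2 ^ a : ℝ) • c i.2,
      fun i => i.1.1.2 ^ a * ρ i.2, fun i => ⟨?_, ?_⟩, ?_, ?_⟩
    · exact mul_nonneg (Real.rpow_nonneg ((P k).pos _ i.1.2).le _) (hρ i.2).1
    · rw [pow_succ']
      exact mul_le_mul (((P k).rpow_le ha i.1.2).trans ((P k).le_half _ i.1.2)) (hρ i.2).2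
        (hρ i.2).1 (by norm_num)
    · refine iUnion₂_subset fun p hp => ?_
      rintro _ ⟨z, hz, rfl⟩
      obtain ⟨i, hi⟩ := mem_iUnion.1 (hc hz)
      refine mem_iUnion.2 ⟨(⟨p, hp⟩, i), ?_⟩
      rw [mem_closedBall_iff_norm] at hi ⊢
      simp only [add_sub_add_left_eq_sub, ← smul_sub, norm_smul]
      have h3 := Real.rpow_nonneg ((P k).pos p hp).le a
      rw [Real.norm_of_nonneg h3]
      exact mul_le_mul_of_nonneg_left hi h3
    · rw [Fintype.sum_prod_type]
      have h1 : ∀ (p : (P k).disks) (i : ι), (p.1.2 ^ a * ρ i) ^ (2 / a) =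
          p.1.2 ^ 2 * ρ i ^ (2 / a) := by
        intro p i
        have h0 := ((P k).pos _ p.2).le
        rw [Real.mul_rpow (Real.rpow_nonneg h0 _) (hρ i).1, ← Real.rpow_mul h0,
          mul_div_cancel₀ _ (by linarith : a ≠ 0), Real.rpow_two]
      simp only [h1, ← Finset.mul_sum]
      rw [← Finset.sum_mul]
      refine mul_le_one₀ ?_ (Finset.sum_nonneg fun i _ => Real.rpow_nonneg (hρ i).1 _) hs
      rw [Finset.sum_coe_sort (P k).disks fun p => p.2 ^ 2]
      exact (P k).sum_sq_le_one

theorem hausdorffMeasure_packingCantor_lt_top (P : ℕ → DiskPacking) {a : ℝ} (ha : 1 ≤ a) :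
    μH[2 / a] (packingCantor P a) < ⊤ := by
  choose ι hι c ρ hρ hc hs using fun N => exists_cover_cantorStage P ha N 0
  have ha' : 0 ≤ 2 / a := by positivity
  have hd : ∀ N i, Metric.ediam (Metric.closedBall (c N i) (ρ N i)) ≤
      ENNReal.ofReal (2 * ρ N i) := by
    intro N i
    refine Metric.ediam_le fun x hx y hy => ?_
    rw [edist_dist]
    refine ENNReal.ofReal_le_ofReal ?_
    have h1 := dist_triangle_right x y (c N i)
    have h2 := Metric.mem_closedBall.1 hx
    have h3 := Metric.mem_closedBall.1 hy
    linarith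
  have key := Measure.hausdorffMeasure_le_liminf_sum (2 / a) (packingCantor P a) (l := atTop)
    (fun N : ℕ => ENNReal.ofReal (2 * (1 / 2) ^ N)) ?_
    (fun N i => Metric.closedBall (c N i) (ρ N i)) ?_ ?_
  · refine (key.trans (?_ : _ ≤ ENNReal.ofReal (2 ^ (2 / a)))).trans_lt
      ENNReal.ofReal_lt_top
    refine liminf_le_of_le (by isBoundedDefault) fun b hb => ?_
    obtain ⟨N, hN⟩ := hb.exists
    refine hN.trans ?_
    calc ∑ i, Metric.ediam (Metric.closedBall (c N i) (ρ N i)) ^ (2 / a)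
        ≤ ∑ i, ENNReal.ofReal (2 ^ (2 / a) * ρ N i ^ (2 / a)) := by
          refine Finset.sum_le_sum fun i _ => ?_
          rw [← Real.mul_rpow zero_le_two (hρ N i).1,
            ← ENNReal.ofReal_rpow_of_nonneg (mul_nonneg zero_le_two (hρ N i).1) ha']
          exact ENNReal.rpow_le_rpow (hd N i) ha'
      _ = ENNReal.ofReal (2 ^ (2 / a) * ∑ i, ρ N i ^ (2 / a)) := by
          rw [Finset.mul_sum, ENNReal.ofReal_sum_of_nonneg]
          exact fun i _ => mul_nonneg (by positivity) (Real.rpow_nonneg (hρ N i).1 _)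
      _ ≤ _ := by
          refine ENNReal.ofReal_le_ofReal ?_
          exact mul_le_of_le_one_right (by positivity) (hs N)
  · rw [← ENNReal.ofReal_zero]
    refine ENNReal.tendsto_ofReal ?_
    simpa using (tendsto_pow_atTop_nhds_zero_of_lt_one (r := (1 / 2 : ℝ)) (by norm_num)
      (by norm_num)).const_mul 2
  · refine Eventually.of_forall fun N i => (hd N i).trans (ENNReal.ofReal_le_ofReal ?_)
    linarith [(hρ N i).2]
  · exact Eventually.of_forall fun N => (iInter_subset _ N).trans (hc N)

/-! ### Positive area for exponent 1 -/

theorem volume_image_add_smul (c : ℂ) (r : ℝ) (s : Set ℂ) :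
    volume ((fun z : ℂ => c + r • z) '' s) = ENNReal.ofReal (r ^ 2) * volume s := by
  have : (fun z : ℂ => c + r • z) '' s = (fun z => c + z) '' ((fun z : ℂ => r • z) '' s) := by
    rw [image_image]
  rw [this, Set.image_add_left, measure_preimage_add]
  change volume (r • s) = _
  rw [Measure.addHaar_smul, Complex.finrank_real_complex, abs_of_nonneg (sq_nonneg r)]

/-- If the packings miss little area, the stages with unreduced radii keep at least half the area
of the unit disk. -/
theorem le_volume_cantorStage_one (P : ℕ → DiskPacking)
    (hP : ∀ k : ℕ, 1 - 1 / ((k : ℝ) + 2) ^ 2 ≤ ∑ p ∈ (P k).disks, p.2 ^ 2) (N k : ℕ) :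
    ENNReal.ofReal ((k + 1) / (k + 2)) ≤ volume (cantorStage P 1 N k) := by
  induction N generalizing k with
  | zero =>
    rw [cantorStage, Complex.volume_closedBall]
    have h1 : ENNReal.ofReal (((k : ℝ) + 1) / (k + 2)) ≤ 1 := by
      rw [ENNReal.ofReal_le_one, div_le_one (by positivity)]
      linarith
    refine h1.trans ?_
    simp only [ENNReal.ofReal_one, one_pow, one_mul]
    rw [ENNReal.one_le_coe_iff, ← NNReal.coe_le_coe]
    simpa using (by norm_num : (1 : ℝ) ≤ 3).trans Real.pi_gt_three.le
  | succ N ih =>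
    have hd : ((P k).disks : Set (ℂ × ℝ)).PairwiseDisjoint fun p =>
        (fun z : ℂ => p.1 + (p.2 ^ (1 : ℝ) : ℝ) • z) '' cantorStage P 1 N (k + 1) := by
      refine (P k).pairwiseDisjoint.mono_on fun p hp => ?_
      rintro _ ⟨z, hz, rfl⟩
      have h1 : ‖z‖ ≤ 1 := by simpa using cantorStage_subset_closedBall P le_rfl N (k + 1) hz
      have h0 := (P k).pos p hp
      rw [mem_closedBall_iff_norm, add_sub_cancel_left, norm_smul, Real.rpow_one,
        Real.norm_of_nonneg h0.le]
      exact mul_le_of_le_one_right h0.le h1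
    rw [cantorStage, measure_biUnion_finset hd fun p _ =>
      ((isCompact_cantorStage P 1 N (k + 1)).image (by fun_prop)).measurableSet]
    simp only [volume_image_add_smul, Real.rpow_one]
    rw [← Finset.sum_mul, ← ENNReal.ofReal_sum_of_nonneg fun _ _ => sq_nonneg _]
    refine le_trans ?_ (mul_le_mul' (ENNReal.ofReal_le_ofReal (hP k)) (ih (k + 1)))
    rw [← ENNReal.ofReal_mul']
    -- The bound was chosen to telescope: (1 - 1/(k+2)²) · (k+2)/(k+3) = (k+1)/(k+2).
    · refine ENNReal.ofReal_le_ofReal (le_of_eq ?_)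
      push_cast
      field_simp
      ring
    · positivity

theorem volume_packingCantor_one_pos (P : ℕ → DiskPacking)
    (hP : ∀ k : ℕ, 1 - 1 / ((k : ℝ) + 2) ^ 2 ≤ ∑ p ∈ (P k).disks, p.2 ^ 2) :
    0 < volume (packingCantor P 1) := by
  have h := tendsto_measure_iInter_atTop (μ := volume) (s := fun N => cantorStage P 1 N 0)
    (fun N => (isCompact_cantorStage P 1 N 0).measurableSet.nullMeasurableSet)
    (antitone_cantorStage P le_rfl 0) ⟨0, (isCompact_cantorStage P 1 0 0).measure_lt_top.ne⟩
  have h2 := ge_of_tendsto' h fun N => le_volume_cantorStage_one P hP N 0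
  refine lt_of_lt_of_le ?_ h2
  rw [ENNReal.ofReal_pos]
  norm_num

/-- Passing from the Euclidean norm of ℂ to the sup norm of ℝ × ℝ is 1-Lipschitz, and for the sup
norm the 2-dimensional Hausdorff measure is exactly Lebesgue measure. -/
theorem volume_le_hausdorffMeasure_two (s : Set ℂ) : volume s ≤ μH[2] s := by
  have h1 : volume s = volume (Complex.measurableEquivRealProd '' s) := by
    rw [MeasurableEquiv.image_eq_preimage_symm]
    exact ((Complex.volume_preserving_equiv_real_prod.symm).measure_preimage_equiv s).symm
  have hL : LipschitzWith 1 Complex.measurableEquivRealProd := by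
    refine LipschitzWith.of_dist_le_mul fun x y => ?_
    rw [NNReal.coe_one, one_mul, dist_eq_norm x y, Prod.dist_eq]
    refine max_le ?_ ?_
    · simpa [Real.dist_eq] using Complex.abs_re_le_norm (x - y)
    · simpa [Real.dist_eq] using Complex.abs_im_le_norm (x - y)
  rw [h1, ← hausdorffMeasure_prod_real]
  simpa using hL.hausdorffMeasure_image_le (d := 2) zero_le_two s

/-! ### Positivity of the Hausdorff measure by Hölder comparison -/

/-- Pairs of points of the `N`-th stages for the exponents `a` and `1` with the same address. -/
noncomputable def addressPairs (P : ℕ → DiskPacking) (a : ℝ) : ℕ → ℕ → Set (ℂ × ℂ)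
  | 0, _ => Metric.closedBall 0 1 ×ˢ Metric.closedBall 0 1
  | N + 1, k => ⋃ p ∈ (P k).disks,
      (fun z : ℂ × ℂ => (p.1 + (p.2 ^ a : ℝ) • z.1, p.1 + p.2 • z.2)) ''
        addressPairs P a N (k + 1)

theorem isCompact_addressPairs (P : ℕ → DiskPacking) (a : ℝ) (N k : ℕ) :
    IsCompact (addressPairs P a N k) := by
  induction N generalizing k with
  | zero => exact (isCompact_closedBall _ _).prod (isCompact_closedBall _ _)
  | succ N ih =>
    exact (P k).disks.isCompact_biUnion fun p _ => (ih (k + 1)).image (by fun_prop)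

theorem fst_mem_of_mem_addressPairs (P : ℕ → DiskPacking) (a : ℝ) (N k : ℕ) {z : ℂ × ℂ}
    (hz : z ∈ addressPairs P a N k) : z.1 ∈ cantorStage P a N k := by
  induction N generalizing k z with
  | zero => exact hz.1
  | succ N ih =>
    obtain ⟨p, hp, w, hw, rfl⟩ := mem_iUnion₂.1 hz
    exact mem_iUnion₂.2 ⟨p, hp, w.1, ih (k + 1) hw, rfl⟩

theorem snd_mem_of_mem_addressPairs (P : ℕ → DiskPacking) (a : ℝ) (N k : ℕ) {z : ℂ × ℂ}
    (hz : z ∈ addressPairs P a N k) : z.2 ∈ cantorStage P 1 N k := by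
  induction N generalizing k z with
  | zero => exact hz.2
  | succ N ih =>
    obtain ⟨p, hp, w, hw, rfl⟩ := mem_iUnion₂.1 hz
    exact mem_iUnion₂.2 ⟨p, hp, w.2, ih (k + 1) hw, by simp⟩

theorem exists_mem_addressPairs (P : ℕ → DiskPacking) (a : ℝ) (N k : ℕ) {y : ℂ}
    (hy : y ∈ cantorStage P 1 N k) : ∃ x, (x, y) ∈ addressPairs P a N k := by
  induction N generalizing k y with
  | zero => exact ⟨0, by simp, hy⟩
  | succ N ih =>
    obtain ⟨p, hp, w, hw, rfl⟩ := mem_iUnion₂.1 hy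
    obtain ⟨x, hx⟩ := ih (k + 1) hw
    exact ⟨p.1 + (p.2 ^ a : ℝ) • x, mem_iUnion₂.2 ⟨p, hp, (x, w), hx, by simp⟩⟩

theorem addressPairs_succ_subset (P : ℕ → DiskPacking) {a : ℝ} (ha : 1 ≤ a) (N k : ℕ) :
    addressPairs P a (N + 1) k ⊆ addressPairs P a N k := by
  induction N generalizing k with
  | zero =>
    exact fun z hz => ⟨cantorStage_subset_closedBall P ha 1 k (fst_mem_of_mem_addressPairs P a _ _ hz),
      cantorStage_subset_closedBall P le_rfl 1 k (snd_mem_of_mem_addressPairs P a _ _ hz)⟩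
  | succ N ih => exact iUnion₂_mono fun p _ => image_mono (ih (k + 1))

/-- This is the Hölder estimate up to an error that dies as N grows. Inside a common disk both sides
scale by R, since (R^a)^(1/a) = R. Once the addresses split, with centres at distance s ≤ 2, the
second coordinates differ by at most 2s and the first by at least s/2. As s/2 ≤ 1, 2s = 4(s/2) ≤
4(s/2)^(1/a), whence the constant 4. -/
theorem norm_sub_le_of_mem_addressPairs (P : ℕ → DiskPacking) {a : ℝ} (ha : 1 ≤ a)
    (hP : ∀ k, ∀ p ∈ (P k).disks, p.2 ^ a ≤ p.2 / 2) (N k : ℕ) {z w : ℂ × ℂ}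
    (hz : z ∈ addressPairs P a N k) (hw : w ∈ addressPairs P a N k) :
    ‖z.2 - w.2‖ ≤ 4 * ‖z.1 - w.1‖ ^ (1 / a) + 2 * (1 / 2) ^ N := by
  have ha0 : 0 < a := by linarith
  induction N generalizing k z w with
  | zero =>
    have h1 : ‖z.2‖ ≤ 1 := by simpa using hz.2
    have h2 : ‖w.2‖ ≤ 1 := by simpa using hw.2
    have h3 := norm_sub_le z.2 w.2
    have h4 : 0 ≤ ‖z.1 - w.1‖ ^ (1 / a) := by positivity
    simp only [pow_zero]
    linarith
  | succ N ih =>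
    obtain ⟨p, hp, z, hz', rfl⟩ := mem_iUnion₂.1 hz
    obtain ⟨q, hq, w, hw', rfl⟩ := mem_iUnion₂.1 hw
    clear hz hw
    rename' hz' => hz, hw' => hw
    have hp0 := (P k).pos p hp
    by_cases hpq : p = q
    · subst hpq
      simp only [add_sub_add_left_eq_sub, ← smul_sub, norm_smul]
      rw [Real.norm_of_nonneg hp0.le, Real.norm_of_nonneg (Real.rpow_nonneg hp0.le _),
        Real.mul_rpow (Real.rpow_nonneg hp0.le _) (norm_nonneg _), ← Real.rpow_mul hp0.le,
        mul_one_div_cancel ha0.ne', Real.rpow_one, pow_succ]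
      have h1 := ih (k + 1) hz hw
      have h2 := (P k).le_half p hp
      have h3 : (0 : ℝ) < (1 / 2) ^ N := by positivity
      nlinarith
    · have hq0 := (P k).pos q hq
      have hz1 : ‖z.1‖ ≤ 1 := by
        simpa using cantorStage_subset_closedBall P ha _ _ (fst_mem_of_mem_addressPairs P a _ _ hz)
      have hz2 : ‖z.2‖ ≤ 1 := by
        simpa using cantorStage_subset_closedBall P le_rfl _ _
          (snd_mem_of_mem_addressPairs P a _ _ hz)
      have hw1 : ‖w.1‖ ≤ 1 := by
        simpa using cantorStage_subset_closedBall P ha _ _ (fst_mem_of_mem_addressPairs P a _ _ hw)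
      have hw2 : ‖w.2‖ ≤ 1 := by
        simpa using cantorStage_subset_closedBall P le_rfl _ _
          (snd_mem_of_mem_addressPairs P a _ _ hw)
      have hs := (P k).add_lt_norm p hp q hq hpq
      have hs2 : ‖p.1 - q.1‖ ≤ 2 := by
        have h1 := norm_sub_le p.1 q.1
        have h2 := (P k).norm_add_le p hp
        have h3 := (P k).norm_add_le q hq
        linarith
      have e1 : ‖(p.1 + p.2 • z.2) - (q.1 + q.2 • w.2)‖ ≤ 2 * ‖p.1 - q.1‖ := by
        have : (p.1 + p.2 • z.2) - (q.1 + q.2 • w.2) = (p.1 - q.1) + p.2 • z.2 - q.2 • w.2 := by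
          ring
        rw [this]
        have h1 := norm_sub_le ((p.1 - q.1) + p.2 • z.2) (q.2 • w.2)
        have h2 := norm_add_le (p.1 - q.1) (p.2 • z.2)
        rw [norm_smul, Real.norm_of_nonneg hp0.le] at h2
        rw [norm_smul, Real.norm_of_nonneg hq0.le] at h1
        nlinarith
      -- Halving the radii (`hP`) leaves a gap: s - R_p^a - R_q^a ≥ s - (R_p + R_q)/2 ≥ s/2.
      have e2 : ‖p.1 - q.1‖ / 2 ≤
          ‖(p.1 + (p.2 ^ a : ℝ) • z.1) - (q.1 + (q.2 ^ a : ℝ) • w.1)‖ := by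
        have : p.1 - q.1 = ((p.1 + (p.2 ^ a : ℝ) • z.1) - (q.1 + (q.2 ^ a : ℝ) • w.1)) -
            (p.2 ^ a : ℝ) • z.1 + (q.2 ^ a : ℝ) • w.1 := by ring
        have h1 := norm_add_le (((p.1 + (p.2 ^ a : ℝ) • z.1) - (q.1 + (q.2 ^ a : ℝ) • w.1)) -
            (p.2 ^ a : ℝ) • z.1) ((q.2 ^ a : ℝ) • w.1)
        have h2 := norm_sub_le ((p.1 + (p.2 ^ a : ℝ) • z.1) - (q.1 + (q.2 ^ a : ℝ) • w.1))
          ((p.2 ^ a : ℝ) • z.1)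
        rw [← this] at h1
        have hpa := Real.rpow_nonneg hp0.le a
        have hqa := Real.rpow_nonneg hq0.le a
        rw [norm_smul, Real.norm_of_nonneg hqa] at h1
        rw [norm_smul ((p.2 ^ a : ℝ)), Real.norm_of_nonneg hpa] at h2
        have h3 := hP k p hp
        have h4 := hP k q hq
        nlinarith
      have e3 : ‖p.1 - q.1‖ / 2 ≤ (‖p.1 - q.1‖ / 2) ^ (1 / a) := by
        have := Real.rpow_le_rpow_of_exponent_ge' (x := ‖p.1 - q.1‖ / 2) (by positivity)
          (by linarith) (by positivity : 0 ≤ 1 / a) ((div_le_one ha0).2 ha)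
        rwa [Real.rpow_one] at this
      have e4 := Real.rpow_le_rpow (by positivity) e2 (by positivity : 0 ≤ 1 / a)
      have : (0 : ℝ) < (1 / 2) ^ (N + 1) := by positivity
      simp only
      linarith

/-- Compactness selects, for each point y of the 1-set, a partner x(y) sharing its address at all
depths. Then x is injective with 1/a-Hölder inverse, so the positive area of the 1-set is bounded by
a constant times the 2/a-measure of the image of x. -/
theorem hausdorffMeasure_packingCantor_pos (P : ℕ → DiskPacking) {a : ℝ} (ha : 1 ≤ a)
    (hP : ∀ k, ∀ p ∈ (P k).disks, p.2 ^ a ≤ p.2 / 2)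
    (hP' : ∀ k : ℕ, 1 - 1 / ((k : ℝ) + 2) ^ 2 ≤ ∑ p ∈ (P k).disks, p.2 ^ 2) :
    0 < μH[2 / a] (packingCantor P a) := by
  have ha0 : 0 < a := by linarith
  have hex : ∀ y ∈ packingCantor P 1, ∃ x, ∀ N, (x, y) ∈ addressPairs P a N 0 := by
    intro y hy
    have hcl : IsClosed {z : ℂ × ℂ | z.2 = y} := isClosed_eq continuous_snd continuous_const
    obtain ⟨z, hz⟩ := IsCompact.nonempty_iInter_of_sequence_nonempty_isCompact_isClosed
      (fun N => addressPairs P a N 0 ∩ {z | z.2 = y})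
      (fun N => inter_subset_inter_left _ (addressPairs_succ_subset P ha N 0))
      (fun N => by
        obtain ⟨x, hx⟩ := exists_mem_addressPairs P a N 0 (mem_iInter.1 hy N)
        exact ⟨_, hx, rfl⟩)
      ((isCompact_addressPairs P a 0 0).inter_right hcl)
      (fun N => (isCompact_addressPairs P a N 0).isClosed.inter hcl)
    have hz' := fun N => mem_iInter.1 hz N
    refine ⟨z.1, fun N => ?_⟩
    have e : z.2 = y := (hz' 0).2
    rw [← e]
    exact (hz' N).1
  choose! x hx using hex
  have hdist : ∀ y ∈ packingCantor P 1, ∀ y' ∈ packingCantor P 1,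
      ‖y - y'‖ ≤ 4 * ‖x y - x y'‖ ^ (1 / a) := by
    intro y hy y' hy'
    have ht : Tendsto (fun N : ℕ => 4 * ‖x y - x y'‖ ^ (1 / a) + 2 * (1 / 2 : ℝ) ^ N) atTop
        (𝓝 (4 * ‖x y - x y'‖ ^ (1 / a) + 2 * 0)) :=
      ((tendsto_pow_atTop_nhds_zero_of_lt_one (by norm_num) (by norm_num)).const_mul 2).const_add _
    rw [mul_zero, add_zero] at ht
    exact ge_of_tendsto' ht fun N =>
      norm_sub_le_of_mem_addressPairs P ha hP N 0 (hx y hy N) (hx y' hy' N)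
  have hinj : InjOn x (packingCantor P 1) := by
    intro y hy y' hy' h
    have := hdist y hy y' hy'
    rw [h, sub_self, norm_zero, Real.zero_rpow (by positivity), mul_zero] at this
    exact sub_eq_zero.1 (norm_le_zero_iff.1 this)
  have hleft := hinj.leftInvOn_invFunOn
  have hhol : HolderOnWith 4 (1 / a).toNNReal (Function.invFunOn x (packingCantor P 1))
      (x '' packingCantor P 1) := by
    rintro _ ⟨y, hy, rfl⟩ _ ⟨y', hy', rfl⟩
    rw [hleft hy, hleft hy', edist_dist, edist_dist, Real.coe_toNNReal _ (by positivity),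
      ENNReal.ofReal_rpow_of_nonneg dist_nonneg (by positivity), dist_eq_norm, dist_eq_norm]
    have : ((4 : NNReal) : ℝ≥0∞) = ENNReal.ofReal 4 := by simp
    rw [this, ← ENNReal.ofReal_mul (by norm_num)]
    exact ENNReal.ofReal_le_ofReal (hdist y hy y' hy')
  have key := hhol.hausdorffMeasure_image_le (by simpa using ha0) (d := 2) zero_le_two
  rw [hleft.image_image, Real.coe_toNNReal _ (by positivity), one_div_mul_eq_div] at key
  have hsub : x '' packingCantor P 1 ⊆ packingCantor P a := by
    rintro _ ⟨y, hy, rfl⟩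
    exact mem_iInter.2 fun N => fst_mem_of_mem_addressPairs P a N 0 (hx y hy N)
  have hpos : 0 < ((4 : NNReal) : ℝ≥0∞) ^ (2 : ℝ) * μH[2 / a] (x '' packingCantor P 1) :=
    ((volume_packingCantor_one_pos P hP').trans_le (volume_le_hausdorffMeasure_two _)).trans_le key
  exact (pos_of_mul_pos_right hpos (zero_le)).trans_le (measure_mono hsub)

/-! ### Radial stretchings -/

/-- The radial map which is the identity for `R ≤ ‖z‖`, is the power map with radial exponent `θ`
for `R ^ a ≤ ‖z‖ ≤ R`, and is a homothety for `‖z‖ ≤ R ^ a`. -/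
noncomputable def radialStretch (R a θ : ℝ) (z : ℂ) : ℂ :=
  ((max (R ^ a) (min ‖z‖ R) / R) ^ (θ - 1) : ℝ) • z

section radialStretch

variable {R a θ : ℝ}

theorem Real.rpow_le_self_of_half (hR : 0 < R) (hR2 : R ≤ 1 / 2) (ha : 1 ≤ a) : R ^ a ≤ R := by
  have h := Real.rpow_le_rpow_of_exponent_ge hR (hR2.trans (by norm_num)) ha
  rwa [Real.rpow_one] at h

theorem radialStretch_of_le (hR : 0 < R) (haR : R ^ a ≤ R) {z : ℂ} (hz : ‖z‖ ≤ R ^ a) :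
    radialStretch R a θ z = (R ^ ((θ - 1) * (a - 1)) : ℝ) • z := by
  rw [radialStretch, min_eq_left (hz.trans haR), max_eq_left hz, mul_comm (θ - 1),
    Real.rpow_mul hR.le, Real.rpow_sub hR, Real.rpow_one]

theorem radialStretch_of_ge (hR : 0 < R) (haR : R ^ a ≤ R) {z : ℂ} (hz : R ≤ ‖z‖) :
    radialStretch R a θ z = z := by
  rw [radialStretch, min_eq_right hz, max_eq_right haR, div_self hR.ne', Real.one_rpow, one_smul]

theorem radialStretch_of_mem {z : ℂ} (h1 : R ^ a ≤ ‖z‖) (h2 : ‖z‖ ≤ R) :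
    radialStretch R a θ z = ((‖z‖ / R) ^ (θ - 1) : ℝ) • z := by
  rw [radialStretch, min_eq_left h2, max_eq_right h1]

theorem norm_radialStretch_of_mem (hR : 0 < R) {z : ℂ} (h1 : R ^ a ≤ ‖z‖) (h2 : ‖z‖ ≤ R) :
    ‖radialStretch R a θ z‖ = R * (‖z‖ / R) ^ θ := by
  have hz : 0 < ‖z‖ := (Real.rpow_pos_of_pos hR a).trans_le h1
  rw [radialStretch_of_mem h1 h2, norm_smul, Real.norm_of_nonneg (by positivity),
    Real.rpow_sub (by positivity), Real.rpow_one]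
  field_simp

theorem norm_radialStretch_le (hR : 0 < R) (hR2 : R ≤ 1 / 2) (ha : 1 ≤ a) (hθ : 0 < θ)
    {z : ℂ} (hz : ‖z‖ ≤ R) : ‖radialStretch R a θ z‖ ≤ R := by
  have haR := Real.rpow_le_self_of_half hR hR2 ha
  rcases le_total ‖z‖ (R ^ a) with h | h
  · rw [radialStretch_of_le hR haR h, norm_smul,
      Real.norm_of_nonneg (Real.rpow_nonneg hR.le _)]
    calc R ^ ((θ - 1) * (a - 1)) * ‖z‖ ≤ R ^ ((θ - 1) * (a - 1)) * R ^ a := by gcongr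
      _ = R ^ (1 + θ * (a - 1)) := by rw [← Real.rpow_add hR]; congr 1; ring
      _ ≤ R := Real.rpow_le_self_of_half hR hR2 (by nlinarith)
  · rw [norm_radialStretch_of_mem hR h hz]
    refine mul_le_of_le_one_right hR.le (Real.rpow_le_one (by positivity) ?_ hθ.le)
    exact (div_le_one hR).2 hz

/-- With b = 1 + θ(a-1) one has R^b = R (R^a/R)^θ, the radius of the image of the inner disk. So the
inverse belongs to the same family, with parameters (b, θ⁻¹), and every statement about these maps
also serves for their inverses. -/
theorem radialStretch_inverse (hR : 0 < R) (hR2 : R ≤ 1 / 2) (ha : 1 ≤ a) (hθ : 0 < θ) (z : ℂ) :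
    radialStretch R (1 + θ * (a - 1)) θ⁻¹ (radialStretch R a θ z) = z := by
  have haR := Real.rpow_le_self_of_half hR hR2 ha
  have hbR : R ^ (1 + θ * (a - 1)) ≤ R := Real.rpow_le_self_of_half hR hR2 (by nlinarith)
  rcases le_total ‖z‖ (R ^ a) with h | h
  · rw [radialStretch_of_le hR haR h, radialStretch_of_le hR hbR, smul_smul, ← Real.rpow_add hR]
    · have : (θ⁻¹ - 1) * (1 + θ * (a - 1) - 1) + (θ - 1) * (a - 1) = 0 := by
        field_simp; ring
      rw [this, Real.rpow_zero, one_smul]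
    · rw [norm_smul, Real.norm_of_nonneg (Real.rpow_nonneg hR.le _)]
      calc R ^ ((θ - 1) * (a - 1)) * ‖z‖ ≤ R ^ ((θ - 1) * (a - 1)) * R ^ a := by gcongr
        _ = R ^ (1 + θ * (a - 1)) := by rw [← Real.rpow_add hR]; congr 1; ring
  rcases le_total ‖z‖ R with h' | h'
  · have hz : 0 < ‖z‖ := (Real.rpow_pos_of_pos hR a).trans_le h
    have hn := norm_radialStretch_of_mem (θ := θ) hR h h'
    rw [radialStretch_of_mem (a := 1 + θ * (a - 1)), hn, radialStretch_of_mem h h', smul_smul,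
      mul_div_cancel_left₀ _ hR.ne', ← Real.rpow_mul (by positivity),
      ← Real.rpow_add (by positivity)]
    · have : θ * (θ⁻¹ - 1) + (θ - 1) = 0 := by field_simp; ring
      rw [this, Real.rpow_zero, one_smul]
    · rw [hn]
      calc R ^ (1 + θ * (a - 1)) = R * (R ^ a / R) ^ θ := by
            rw [Real.rpow_add hR, Real.rpow_one, mul_comm θ, Real.rpow_mul hR.le,
              Real.rpow_sub hR, Real.rpow_one]
        _ ≤ _ := by gcongr
    · exact norm_radialStretch_le hR hR2 ha hθ h'
  · rw [radialStretch_of_ge hR haR h', radialStretch_of_ge hR hbR h']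

theorem exists_lipschitzWith_radialStretch (hR : 0 < R) (haR : R ^ a ≤ R) :
    ∃ C, LipschitzWith C (radialStretch R a θ) := by
  have hRa : 0 < R ^ a := Real.rpow_pos_of_pos hR a
  have hcd : ContDiffOn ℝ 1 (fun t : ℝ => (t / R) ^ (θ - 1)) (Icc (R ^ a) R) := by
    refine ContDiffOn.rpow_const_of_ne (contDiffOn_id.div_const R) fun t ht => ?_
    have : 0 < t := hRa.trans_le ht.1
    exact (div_pos this hR).ne'
  obtain ⟨L, hL⟩ := hcd.exists_lipschitzOnWith one_ne_zero (convex_Icc _ _) isCompact_Icc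
  obtain ⟨M, hM⟩ := isCompact_Icc.exists_bound_of_continuousOn hcd.continuousOn
  set m : ℝ → ℝ := fun t => (max (R ^ a) (min t R) / R) ^ (θ - 1) with hm
  have hmem : ∀ t, max (R ^ a) (min t R) ∈ Icc (R ^ a) R := fun t =>
    ⟨le_max_left _ _, max_le haR (min_le_right _ _)⟩
  have hmM : ∀ t, ‖m t‖ ≤ M := fun t => hM _ (hmem t)
  have hM0 : 0 ≤ M := (norm_nonneg _).trans (hmM 0)
  have hmL : ∀ t s, ‖m t - m s‖ ≤ L * |t - s| := by
    intro t s
    have h1 := hL.dist_le_mul _ (hmem t) _ (hmem s)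
    have h2 : dist (max (R ^ a) (min t R)) (max (R ^ a) (min s R)) ≤ |t - s| := by
      rw [Real.dist_eq, max_comm, max_comm (R ^ a)]
      exact (abs_max_sub_max_le_abs _ _ _).trans (by
        have := abs_min_sub_min_le_max t R s R
        simpa using this)
    rw [dist_eq_norm] at h1
    exact h1.trans (by gcongr)
  -- In m(z)z - m(w)w = m(z)(z-w) + (m(z)-m(w))w the last factor must be bounded, so the point
  -- inside the disk plays the role of w. Two points outside are both fixed.
  have key : ∀ z w : ℂ, ‖w‖ ≤ R →
      ‖radialStretch R a θ z - radialStretch R a θ w‖ ≤ (M + L * R) * ‖z - w‖ := by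
    intro z w hw
    have e : radialStretch R a θ z - radialStretch R a θ w =
        m ‖z‖ • (z - w) + (m ‖z‖ - m ‖w‖) • w := by
      simp only [radialStretch, hm, smul_sub, sub_smul]
      abel
    rw [e]
    refine (norm_add_le _ _).trans ?_
    rw [norm_smul, norm_smul, add_mul]
    refine add_le_add (by gcongr; exact hmM _) ?_
    calc ‖m ‖z‖ - m ‖w‖‖ * ‖w‖ ≤ (L * |‖z‖ - ‖w‖|) * R := by gcongr; exact hmL _ _
      _ ≤ (L * ‖z - w‖) * R := by gcongr; exact abs_norm_sub_norm_le z w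
      _ = L * R * ‖z - w‖ := by ring
  refine ⟨(max 1 (M + L * R)).toNNReal, LipschitzWith.of_dist_le_mul fun z w => ?_⟩
  rw [Real.coe_toNNReal _ (by positivity), dist_eq_norm, dist_eq_norm]
  rcases le_total ‖w‖ R with hw | hw
  · exact (key z w hw).trans (by gcongr; exact le_max_right _ _)
  rcases le_total ‖z‖ R with hz | hz
  · rw [norm_sub_rev, norm_sub_rev z]
    exact (key w z hz).trans (by gcongr; exact le_max_right _ _)
  · rw [radialStretch_of_ge hR haR hw, radialStretch_of_ge hR haR hz]
    exact le_mul_of_one_le_left (norm_nonneg _) (le_max_left _ _)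

end radialStretch

/-! ### Inserting and gluing disk maps -/

/-- Continuous maps of the plane that preserve the closed unit disk and fix its exterior. -/
structure IsDiskMap (ψ : ℂ → ℂ) : Prop where
  continuous : Continuous ψ
  eq_self : ∀ z, 1 ≤ ‖z‖ → ψ z = z
  norm_le : ∀ z, ‖z‖ ≤ 1 → ‖ψ z‖ ≤ 1

/-- The radial map of the disk of radius `R`, with a scaled copy of `ψ` in its inner disk. -/
noncomputable def diskMap (R a θ : ℝ) (ψ : ℂ → ℂ) (z : ℂ) : ℂ :=
  radialStretch R a θ ((R ^ a : ℝ) • ψ ((R ^ a : ℝ)⁻¹ • z))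

section diskMap

variable {R a θ : ℝ} {ψ : ℂ → ℂ}

theorem norm_inv_smul_le_one_iff (hR : 0 < R) {z : ℂ} :
    ‖(R ^ a : ℝ)⁻¹ • z‖ ≤ 1 ↔ ‖z‖ ≤ R ^ a := by
  have h := Real.rpow_pos_of_pos hR a
  rw [norm_smul, norm_inv, Real.norm_of_nonneg h.le, inv_mul_le_one₀ h]

theorem one_le_norm_inv_smul_iff (hR : 0 < R) {z : ℂ} :
    1 ≤ ‖(R ^ a : ℝ)⁻¹ • z‖ ↔ R ^ a ≤ ‖z‖ := by
  have h := Real.rpow_pos_of_pos hR a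
  rw [norm_smul, norm_inv, Real.norm_of_nonneg h.le, one_le_inv_mul₀ h]

theorem diskMap_of_le (hψ : IsDiskMap ψ) (hR : 0 < R) (haR : R ^ a ≤ R) {z : ℂ}
    (hz : ‖z‖ ≤ R ^ a) :
    diskMap R a θ ψ z = (R ^ (1 + θ * (a - 1)) : ℝ) • ψ ((R ^ a : ℝ)⁻¹ • z) := by
  have h := Real.rpow_pos_of_pos hR a
  rw [diskMap, radialStretch_of_le hR haR, smul_smul, ← Real.rpow_add hR]
  · congr 2; ring
  · rw [norm_smul, Real.norm_of_nonneg h.le]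
    exact mul_le_of_le_one_right h.le (hψ.norm_le _ ((norm_inv_smul_le_one_iff hR).2 hz))

theorem diskMap_of_ge (hψ : IsDiskMap ψ) (hR : 0 < R) {z : ℂ} (hz : R ^ a ≤ ‖z‖) :
    diskMap R a θ ψ z = radialStretch R a θ z := by
  rw [diskMap, hψ.eq_self _ ((one_le_norm_inv_smul_iff hR).2 hz),
    smul_inv_smul₀ (Real.rpow_pos_of_pos hR a).ne']

theorem diskMap_eq_self (hψ : IsDiskMap ψ) (hR : 0 < R) (haR : R ^ a ≤ R) {z : ℂ}
    (hz : R ≤ ‖z‖) : diskMap R a θ ψ z = z := by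
  rw [diskMap_of_ge hψ hR (haR.trans hz), radialStretch_of_ge hR haR hz]

theorem norm_diskMap_le (hψ : IsDiskMap ψ) (hR : 0 < R) (hR2 : R ≤ 1 / 2) (ha : 1 ≤ a)
    (hθ : 0 < θ) {z : ℂ} (hz : ‖z‖ ≤ R) : ‖diskMap R a θ ψ z‖ ≤ R := by
  have haR := Real.rpow_le_self_of_half hR hR2 ha
  rcases le_total (R ^ a) ‖z‖ with h | h
  · rw [diskMap_of_ge hψ hR h]
    exact norm_radialStretch_le hR hR2 ha hθ hz
  · refine norm_radialStretch_le hR hR2 ha hθ ?_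
    have h' := Real.rpow_pos_of_pos hR a
    rw [norm_smul, Real.norm_of_nonneg h'.le]
    exact (mul_le_of_le_one_right h'.le
      (hψ.norm_le _ ((norm_inv_smul_le_one_iff hR).2 h))).trans haR

theorem diskMap_inverse {χ : ℂ → ℂ} (hψ : IsDiskMap ψ) (hχ : IsDiskMap χ)
    (hinv : ∀ z, χ (ψ z) = z) (hR : 0 < R) (hR2 : R ≤ 1 / 2) (ha : 1 ≤ a) (hθ : 0 < θ) (z : ℂ) :
    diskMap R (1 + θ * (a - 1)) θ⁻¹ χ (diskMap R a θ ψ z) = z := by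
  have haR := Real.rpow_le_self_of_half hR hR2 ha
  have hb : 1 ≤ 1 + θ * (a - 1) := by nlinarith
  have hbR : R ^ (1 + θ * (a - 1)) ≤ R := Real.rpow_le_self_of_half hR hR2 hb
  have hb0 := Real.rpow_pos_of_pos hR (1 + θ * (a - 1))
  rcases le_total ‖z‖ (R ^ a) with h | h
  · rw [diskMap_of_le hψ hR haR h, diskMap_of_le hχ hR hbR, inv_smul_smul₀ hb0.ne', hinv]
    · have : 1 + θ⁻¹ * (1 + θ * (a - 1) - 1) = a := by field_simp; ring
      rw [this, smul_inv_smul₀ (Real.rpow_pos_of_pos hR a).ne']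
    · rw [norm_smul, Real.norm_of_nonneg hb0.le]
      exact mul_le_of_le_one_right hb0.le (hψ.norm_le _ ((norm_inv_smul_le_one_iff hR).2 h))
  · rw [diskMap_of_ge hψ hR h, diskMap_of_ge hχ hR, radialStretch_inverse hR hR2 ha hθ]
    rcases le_total ‖z‖ R with h' | h'
    · rw [norm_radialStretch_of_mem hR h h']
      calc R ^ (1 + θ * (a - 1)) = R * (R ^ a / R) ^ θ := by
            rw [Real.rpow_add hR, Real.rpow_one, mul_comm θ, Real.rpow_mul hR.le,
              Real.rpow_sub hR, Real.rpow_one]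
        _ ≤ _ := by gcongr
    · rw [radialStretch_of_ge hR haR h']
      exact hbR.trans h'

end diskMap

/-- The map which is a scaled copy of `diskMap R a θ ψ` in each disk of the packing and the
identity elsewhere. -/
noncomputable def glueDisks (P : DiskPacking) (a θ : ℝ) (ψ : ℂ → ℂ) (z : ℂ) : ℂ :=
  z + ∑ p ∈ P.disks, (diskMap p.2 a θ ψ (z - p.1) - (z - p.1))

section glueDisks

variable {P : DiskPacking} {a θ : ℝ} {ψ : ℂ → ℂ}

theorem DiskPacking.le_norm_sub (P : DiskPacking) {p q : ℂ × ℝ} (hp : p ∈ P.disks)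
    (hq : q ∈ P.disks) (hpq : q ≠ p) {z : ℂ} (hz : ‖z - p.1‖ ≤ p.2) : q.2 ≤ ‖z - q.1‖ := by
  have h1 := P.add_lt_norm q hq p hp hpq
  have h2 : ‖q.1 - p.1‖ ≤ ‖z - p.1‖ + ‖z - q.1‖ := by
    have := norm_sub_le (z - p.1) (z - q.1)
    rwa [sub_sub_sub_cancel_left] at this
  linarith

theorem glueDisks_of_mem (hψ : IsDiskMap ψ) (ha : 1 ≤ a) {p : ℂ × ℝ} (hp : p ∈ P.disks) {z : ℂ}
    (hz : ‖z - p.1‖ ≤ p.2) : glueDisks P a θ ψ z = p.1 + diskMap p.2 a θ ψ (z - p.1) := by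
  rw [glueDisks, Finset.sum_eq_single_of_mem p hp]
  · ring
  · intro q hq hqp
    rw [diskMap_eq_self hψ (P.pos q hq) (P.rpow_le ha hq) (P.le_norm_sub hp hq hqp hz), sub_self]

theorem glueDisks_eq_self (hψ : IsDiskMap ψ) (ha : 1 ≤ a) {z : ℂ}
    (hz : ∀ p ∈ P.disks, p.2 ≤ ‖z - p.1‖) : glueDisks P a θ ψ z = z := by
  rw [glueDisks, Finset.sum_eq_zero, add_zero]
  intro p hp
  rw [diskMap_eq_self hψ (P.pos p hp) (P.rpow_le ha hp) (hz p hp), sub_self]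

/-- The glued map sends inner disks to inner disks by rescaled copies of ψ; this is what makes the
nested maps preserve addresses while turning exponent a into b. -/
theorem glueDisks_inner (hψ : IsDiskMap ψ) (ha : 1 ≤ a) {p : ℂ × ℝ} (hp : p ∈ P.disks) {w : ℂ}
    (hw : ‖w‖ ≤ 1) : glueDisks P a θ ψ (p.1 + (p.2 ^ a : ℝ) • w) =
      p.1 + (p.2 ^ (1 + θ * (a - 1)) : ℝ) • ψ w := by
  have hR := P.pos p hp
  have h := Real.rpow_pos_of_pos hR a
  have hn : ‖(p.2 ^ a : ℝ) • w‖ ≤ p.2 ^ a := by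
    rw [norm_smul, Real.norm_of_nonneg h.le]
    exact mul_le_of_le_one_right h.le hw
  have haR := P.rpow_le ha hp
  rw [glueDisks_of_mem hψ ha hp (by rw [add_sub_cancel_left]; exact hn.trans haR),
    add_sub_cancel_left, diskMap_of_le hψ hR haR hn, inv_smul_smul₀ h.ne']

/-- Writing the glued map as the identity plus a finite sum of displacements makes the Lipschitz
property a matter of sums and compositions, with no case analysis across disk boundaries. -/
theorem exists_lipschitzWith_glueDisks (ha : 1 ≤ a) (hψ : ∃ C, LipschitzWith C ψ) :
    ∃ C, LipschitzWith C (glueDisks P a θ ψ) := by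
  classical
  obtain ⟨C, hC⟩ := hψ
  have h1 : ∀ p ∈ P.disks, ∃ D, LipschitzWith D
      (fun z => diskMap p.2 a θ ψ (z - p.1) - (z - p.1)) := by
    intro p hp
    obtain ⟨L, hL⟩ := exists_lipschitzWith_radialStretch (θ := θ) (P.pos p hp) (P.rpow_le ha hp)
    have hsub : LipschitzWith (1 + 0) fun z : ℂ => z - p.1 :=
      LipschitzWith.id.sub (LipschitzWith.const p.1)
    exact ⟨_, ((hL.comp ((lipschitzWith_smul (p.2 ^ a : ℝ)).comp (hC.comp
      (lipschitzWith_smul (p.2 ^ a : ℝ)⁻¹)))).comp hsub).sub hsub⟩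
  have h2 : ∀ s ⊆ P.disks, ∃ D, LipschitzWith D
      (fun z => ∑ p ∈ s, (diskMap p.2 a θ ψ (z - p.1) - (z - p.1))) := by
    intro s
    induction s using Finset.induction_on with
    | empty => exact fun _ => ⟨0, by simp⟩
    | insert p s hps ih =>
      intro hs
      obtain ⟨D, hD⟩ := ih fun q hq => hs (Finset.mem_insert_of_mem hq)
      obtain ⟨D', hD'⟩ := h1 p (hs (Finset.mem_insert_self _ _))
      simp only [Finset.sum_insert hps]
      exact ⟨_, hD'.add hD⟩
  obtain ⟨D, hD⟩ := h2 P.disks subset_rfl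
  exact ⟨_, LipschitzWith.id.add hD⟩

theorem continuous_glueDisks (ha : 1 ≤ a) (hψ : Continuous ψ) :
    Continuous (glueDisks P a θ ψ) := by
  refine continuous_id.add (continuous_finsetSum _ fun p hp => ?_)
  obtain ⟨L, hL⟩ := exists_lipschitzWith_radialStretch (θ := θ) (P.pos p hp) (P.rpow_le ha hp)
  have hc := hL.continuous
  simp only [diskMap]
  fun_prop

theorem IsDiskMap.glueDisks (hψ : IsDiskMap ψ) (ha : 1 ≤ a) (hθ : 0 < θ) :
    IsDiskMap (glueDisks P a θ ψ) where
  continuous := continuous_glueDisks ha hψ.continuous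
  eq_self z hz := by
    refine glueDisks_eq_self hψ ha fun p hp => ?_
    have h1 := P.norm_add_le p hp
    have h2 := norm_sub_norm_le z p.1
    linarith
  norm_le z hz := by
    by_cases h : ∃ p ∈ P.disks, ‖z - p.1‖ ≤ p.2
    · obtain ⟨p, hp, h⟩ := h
      rw [glueDisks_of_mem hψ ha hp h]
      have h1 := P.norm_add_le p hp
      have h2 := norm_diskMap_le hψ (P.pos p hp) (P.le_half p hp) ha hθ h
      exact (norm_add_le _ _).trans (by linarith)
    · push Not at h
      rwa [glueDisks_eq_self hψ ha fun p hp => (h p hp).le]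

theorem glueDisks_inverse {χ : ℂ → ℂ} (hψ : IsDiskMap ψ) (hχ : IsDiskMap χ)
    (hinv : ∀ z, χ (ψ z) = z) (ha : 1 ≤ a) (hθ : 0 < θ) (z : ℂ) :
    glueDisks P (1 + θ * (a - 1)) θ⁻¹ χ (glueDisks P a θ ψ z) = z := by
  have hb : 1 ≤ 1 + θ * (a - 1) := by nlinarith
  by_cases h : ∃ p ∈ P.disks, ‖z - p.1‖ ≤ p.2
  · obtain ⟨p, hp, h⟩ := h
    have h2 := norm_diskMap_le hψ (P.pos p hp) (P.le_half p hp) ha hθ h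
    rw [glueDisks_of_mem hψ ha hp h, glueDisks_of_mem hχ hb hp (by rwa [add_sub_cancel_left]),
      add_sub_cancel_left, diskMap_inverse hψ hχ hinv (P.pos p hp) (P.le_half p hp) ha hθ]
    ring
  · push Not at h
    have h' := fun p hp => (h p hp).le
    rw [glueDisks_eq_self hψ ha h', glueDisks_eq_self hχ hb h']

/-- The two maps differ only in the inner disks, where the difference is scaled by R^b ≤ R ≤ 1/2.
This contraction is the source of the geometric convergence of the nested maps. -/
theorem norm_glueDisks_sub_le {χ : ℂ → ℂ} (hψ : IsDiskMap ψ) (hχ : IsDiskMap χ) (ha : 1 ≤ a)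
    (hθ : 0 < θ) {C : ℝ} (hC : ∀ z, ‖ψ z - χ z‖ ≤ C) (z : ℂ) :
    ‖glueDisks P a θ ψ z - glueDisks P a θ χ z‖ ≤ C / 2 := by
  have hC0 : 0 ≤ C := (norm_nonneg _).trans (hC 0)
  by_cases h : ∃ p ∈ P.disks, ‖z - p.1‖ ≤ p.2
  · obtain ⟨p, hp, h⟩ := h
    have hR := P.pos p hp
    have haR := P.rpow_le ha hp
    rw [glueDisks_of_mem hψ ha hp h, glueDisks_of_mem hχ ha hp h, add_sub_add_left_eq_sub]
    rcases le_total (p.2 ^ a) ‖z - p.1‖ with h' | h'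
    · rw [diskMap_of_ge hψ hR h', diskMap_of_ge hχ hR h', sub_self, norm_zero]
      positivity
    · rw [diskMap_of_le hψ hR haR h', diskMap_of_le hχ hR haR h', ← smul_sub, norm_smul,
        Real.norm_of_nonneg (Real.rpow_nonneg hR.le _)]
      have h1 : p.2 ^ (1 + θ * (a - 1)) ≤ 1 / 2 :=
        (P.rpow_le (by nlinarith) hp).trans (P.le_half p hp)
      calc _ ≤ 1 / 2 * C := by gcongr; exact hC _
        _ = C / 2 := by ring
  · push Not at h
    have h' := fun p hp => (h p hp).le
    rw [glueDisks_eq_self hψ ha h', glueDisks_eq_self hχ ha h', sub_self, norm_zero]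
    positivity

end glueDisks

theorem isDiskMap_id : IsDiskMap id := ⟨continuous_id, fun _ _ => rfl, fun _ h => h⟩

/-! ### Nested maps and their limit homeomorphism -/

/-- The approximating maps carrying the `N`-th stage for the exponent `a` to the `N`-th stage for
the exponent `1 + θ * (a - 1)`. -/
noncomputable def stageMap (P : ℕ → DiskPacking) (a θ : ℝ) : ℕ → ℕ → ℂ → ℂ
  | 0, _ => id
  | N + 1, k => glueDisks (P k) a θ (stageMap P a θ N (k + 1))

section stageMap

variable (P : ℕ → DiskPacking) {a θ : ℝ}

theorem isDiskMap_stageMap (ha : 1 ≤ a) (hθ : 0 < θ) (N k : ℕ) :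
    IsDiskMap (stageMap P a θ N k) := by
  induction N generalizing k with
  | zero => exact isDiskMap_id
  | succ N ih => exact (ih (k + 1)).glueDisks ha hθ

theorem exists_lipschitzWith_stageMap (ha : 1 ≤ a) (N k : ℕ) :
    ∃ C, LipschitzWith C (stageMap P a θ N k) := by
  induction N generalizing k with
  | zero => exact ⟨1, LipschitzWith.id⟩
  | succ N ih => exact exists_lipschitzWith_glueDisks ha (ih (k + 1))

theorem stageMap_inverse (ha : 1 ≤ a) (hθ : 0 < θ) (N k : ℕ) (z : ℂ) :
    stageMap P (1 + θ * (a - 1)) θ⁻¹ N k (stageMap P a θ N k z) = z := by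
  induction N generalizing k z with
  | zero => rfl
  | succ N ih =>
    exact glueDisks_inverse (isDiskMap_stageMap P ha hθ N (k + 1))
      (isDiskMap_stageMap P (by nlinarith) (inv_pos.2 hθ) N (k + 1)) (ih (k + 1)) ha hθ z

theorem stageMap_image_cantorStage (ha : 1 ≤ a) (hθ : 0 < θ) (N k : ℕ) :
    stageMap P a θ N k '' cantorStage P a N k = cantorStage P (1 + θ * (a - 1)) N k := by
  induction N generalizing k with
  | zero => exact image_id _
  | succ N ih =>
    rw [cantorStage, cantorStage, image_iUnion₂]
    refine iUnion₂_congr fun p hp => ?_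
    rw [← ih (k + 1), image_image, image_image]
    refine image_congr fun w hw => ?_
    exact glueDisks_inner (isDiskMap_stageMap P ha hθ N (k + 1)) ha hp
      (by simpa using cantorStage_subset_closedBall P ha _ _ hw)

theorem stageMap_succ_eq_of_notMem (ha : 1 ≤ a) (N k : ℕ) {z : ℂ}
    (hz : z ∉ cantorStage P a N k) : stageMap P a θ (N + 1) k z = stageMap P a θ N k z := by
  induction N generalizing k z with
  | zero =>
    refine glueDisks_eq_self isDiskMap_id ha fun p hp => ?_
    have h1 := (P k).norm_add_le p hp
    have h2 := norm_sub_norm_le z p.1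
    have h3 : 1 < ‖z‖ := by simpa [cantorStage] using hz
    linarith
  | succ N ih =>
    refine congrArg (z + ·) (Finset.sum_congr rfl fun p hp => ?_)
    -- Each summand evaluates the deeper map only at this rescaled point; were it in the deeper
    -- stage, z would lie in the present one.
    have h : ((p.2 ^ a : ℝ)⁻¹ • (z - p.1)) ∉ cantorStage P a N (k + 1) := by
      refine fun h => hz (mem_iUnion₂.2 ⟨p, hp, _, h, ?_⟩)
      simp only
      rw [smul_inv_smul₀ (Real.rpow_pos_of_pos ((P k).pos p hp) a).ne']
      ring
    simp only [diskMap]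
    rw [ih (k + 1) h]

theorem stageMap_eq_of_notMem (ha : 1 ≤ a) {N M : ℕ} (hNM : N ≤ M) {z : ℂ}
    (hz : z ∉ cantorStage P a N 0) : stageMap P a θ M 0 z = stageMap P a θ N 0 z := by
  induction M, hNM using Nat.le_induction with
  | base => rfl
  | succ M hM ih =>
    rw [stageMap_succ_eq_of_notMem P ha M 0 fun h => hz (antitone_cantorStage P ha 0 hM h), ih]

theorem norm_stageMap_succ_sub_le (ha : 1 ≤ a) (hθ : 0 < θ) (N k : ℕ) (z : ℂ) :
    ‖stageMap P a θ (N + 1) k z - stageMap P a θ N k z‖ ≤ 2 / 2 ^ N := by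
  induction N generalizing k z with
  | zero =>
    have h := isDiskMap_stageMap P ha hθ 1 k
    rcases le_total ‖z‖ 1 with hz | hz
    · refine (norm_sub_le _ _).trans ?_
      have h1 := h.norm_le z hz
      simp only [stageMap, id] at h1 ⊢
      norm_num
      linarith
    · rw [h.eq_self z hz]
      simp [stageMap]
  | succ N ih =>
    refine (norm_glueDisks_sub_le (isDiskMap_stageMap P ha hθ (N + 1) (k + 1))
      (isDiskMap_stageMap P ha hθ N (k + 1)) ha hθ (ih (k + 1)) z).trans (le_of_eq ?_)
    rw [pow_succ]
    field_simp

/-- The uniform limit of the approximating maps. -/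
noncomputable def cantorMap (P : ℕ → DiskPacking) (a θ : ℝ) (z : ℂ) : ℂ :=
  limUnder atTop fun N => stageMap P a θ N 0 z

theorem tendsto_stageMap (ha : 1 ≤ a) (hθ : 0 < θ) (z : ℂ) :
    Tendsto (fun N => stageMap P a θ N 0 z) atTop (𝓝 (cantorMap P a θ z)) := by
  refine (cauchySeq_of_le_geometric_two (C := 4) fun N => ?_).tendsto_limUnder
  rw [dist_comm, dist_eq_norm]
  exact (norm_stageMap_succ_sub_le P ha hθ N 0 z).trans (le_of_eq (by ring))

theorem norm_stageMap_sub_cantorMap_le (ha : 1 ≤ a) (hθ : 0 < θ) (N : ℕ) (z : ℂ) :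
    ‖stageMap P a θ N 0 z - cantorMap P a θ z‖ ≤ 4 / 2 ^ N := by
  rw [← dist_eq_norm]
  refine dist_le_of_le_geometric_two_of_tendsto (C := 4) (fun N => ?_)
    (tendsto_stageMap P ha hθ z) N
  rw [dist_comm, dist_eq_norm]
  exact (norm_stageMap_succ_sub_le P ha hθ N 0 z).trans (le_of_eq (by ring))

theorem tendstoUniformly_stageMap (ha : 1 ≤ a) (hθ : 0 < θ) :
    TendstoUniformly (fun N => stageMap P a θ N 0) (cantorMap P a θ) atTop := by
  rw [Metric.tendstoUniformly_iff]
  intro ε hε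
  have h : Tendsto (fun N : ℕ => (4 : ℝ) / 2 ^ N) atTop (𝓝 0) := by
    simpa [div_eq_mul_inv] using (tendsto_pow_atTop_nhds_zero_of_lt_one (r := (1 / 2 : ℝ))
      (by norm_num) (by norm_num)).const_mul 4
  filter_upwards [h.eventually_lt_const hε] with N hN z
  rw [dist_comm, dist_eq_norm]
  exact (norm_stageMap_sub_cantorMap_le P ha hθ N z).trans_lt hN

theorem continuous_cantorMap (ha : 1 ≤ a) (hθ : 0 < θ) : Continuous (cantorMap P a θ) :=
  (tendstoUniformly_stageMap P ha hθ).continuous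
    (Frequently.of_forall fun N => (isDiskMap_stageMap P ha hθ N 0).continuous)

/-- The identity holds at every finite depth and survives because the approximate inverses converge
uniformly to a continuous map. -/
theorem cantorMap_inverse (ha : 1 ≤ a) (hθ : 0 < θ) (z : ℂ) :
    cantorMap P (1 + θ * (a - 1)) θ⁻¹ (cantorMap P a θ z) = z := by
  have hb : 1 ≤ 1 + θ * (a - 1) := by nlinarith
  have h := (tendstoUniformly_stageMap P hb (inv_pos.2 hθ)).tendsto_comp
    (continuous_cantorMap P hb (inv_pos.2 hθ)).continuousAt (tendsto_stageMap P ha hθ z)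
  simp only [stageMap_inverse P ha hθ] at h
  exact tendsto_nhds_unique h tendsto_const_nhds

theorem isHomeomorph_cantorMap (ha : 1 ≤ a) (hθ : 0 < θ) : IsHomeomorph (cantorMap P a θ) := by
  have hb : 1 ≤ 1 + θ * (a - 1) := by nlinarith
  refine (Homeomorph.mk ⟨cantorMap P a θ, cantorMap P (1 + θ * (a - 1)) θ⁻¹,
    cantorMap_inverse P ha hθ, fun z => ?_⟩ (continuous_cantorMap P ha hθ)
    (continuous_cantorMap P hb (inv_pos.2 hθ))).isHomeomorph
  have h := cantorMap_inverse P hb (inv_pos.2 hθ) z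
  have e : 1 + θ⁻¹ * (1 + θ * (a - 1) - 1) = a := by field_simp; ring
  rwa [e, inv_inv] at h

theorem cantorMap_eq_stageMap (ha : 1 ≤ a) (hθ : 0 < θ) {N : ℕ} {z : ℂ}
    (hz : z ∉ cantorStage P a N 0) : cantorMap P a θ z = stageMap P a θ N 0 z := by
  refine tendsto_nhds_unique (tendsto_stageMap P ha hθ z) (tendsto_const_nhds.congr' ?_)
  filter_upwards [eventually_ge_atTop N] with M hM
  exact (stageMap_eq_of_notMem P ha hM hz).symm

/-- Off the N-th stage the limit coincides with the N-th map, a bijection taking stage to stage.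
Since the limit is itself bijective, it must match the N-th stages too, for every N. -/
theorem cantorMap_image_packingCantor (ha : 1 ≤ a) (hθ : 0 < θ) :
    cantorMap P a θ '' packingCantor P a = packingCantor P (1 + θ * (a - 1)) := by
  have hbij := (isHomeomorph_cantorMap P ha hθ).bijective
  have hinj : ∀ N, Function.Injective (stageMap P a θ N 0) := fun N =>
    Function.LeftInverse.injective (stageMap_inverse P ha hθ N 0)
  have key : ∀ N z, cantorMap P a θ z ∈ cantorStage P (1 + θ * (a - 1)) N 0 ↔
      z ∈ cantorStage P a N 0 := by
    intro N z
    rw [← stageMap_image_cantorStage P ha hθ]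
    constructor
    · rintro ⟨x, hx, hxz⟩
      by_contra hz
      rw [cantorMap_eq_stageMap P ha hθ hz] at hxz
      exact hz (hinj N hxz ▸ hx)
    · intro hz
      obtain ⟨x, hx⟩ : ∃ x, stageMap P a θ N 0 x = cantorMap P a θ z := by
        have hb : 1 ≤ 1 + θ * (a - 1) := by nlinarith
        have h := stageMap_inverse P hb (inv_pos.2 hθ) N 0 (cantorMap P a θ z)
        have e : 1 + θ⁻¹ * (1 + θ * (a - 1) - 1) = a := by field_simp; ring
        rw [e, inv_inv] at h
        exact ⟨_, h⟩
      by_cases hxN : x ∈ cantorStage P a N 0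
      · exact ⟨x, hxN, hx⟩
      · rw [← cantorMap_eq_stageMap P ha hθ hxN] at hx
        exact absurd (hbij.1 hx ▸ hz) hxN
  ext y
  obtain ⟨z, rfl⟩ := hbij.2 y
  simp only [hbij.1.mem_set_image, packingCantor, mem_iInter, key]

end stageMap

/-! ### Pointwise distortion -/

/-- `f` is real differentiable at `z`, and its derivative satisfies `‖Df‖² ≤ K * det Df`. -/
def QCAt (K : ℝ) (f : ℂ → ℂ) (z : ℂ) : Prop :=
  ∃ L : ℂ →L[ℝ] ℂ, HasFDerivAt f L z ∧
    ∀ h, ‖L h‖ ^ 2 ≤ K * ((L 1).re * (L Complex.I).im - (L 1).im * (L Complex.I).re) * ‖h‖ ^ 2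

theorem ContinuousLinearMap.det_complex (L : ℂ →L[ℝ] ℂ) :
    L.det = (L 1).re * (L Complex.I).im - (L 1).im * (L Complex.I).re := by
  rw [ContinuousLinearMap.det, ← LinearMap.det_toMatrix Complex.basisOneI, Matrix.det_fin_two]
  simp [LinearMap.toMatrix_apply]
  ring

section QCAt

variable {K : ℝ} {f : ℂ → ℂ} {z : ℂ}

theorem QCAt.congr {g : ℂ → ℂ} (hf : QCAt K f z) (h : g =ᶠ[𝓝 z] f) : QCAt K g z := by
  obtain ⟨L, hL, hb⟩ := hf
  exact ⟨L, hL.congr_of_eventuallyEq h, hb⟩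

theorem qcAt_id (hK : 1 ≤ K) : QCAt K (fun w => w) z := by
  refine ⟨ContinuousLinearMap.id ℝ ℂ, hasFDerivAt_id z, fun h => ?_⟩
  simp only [ContinuousLinearMap.id_apply, Complex.one_re, Complex.I_im, Complex.one_im,
    Complex.I_re]
  nlinarith [sq_nonneg ‖h‖]

/-- Similarities multiply ‖Df‖² and det Df by the same factor (sr)². -/
theorem QCAt.comp_affine {c : ℂ} {r s : ℝ} (hf : QCAt K f (r • (z - c))) :
    QCAt K (fun w => c + s • f (r • (w - c))) z := by
  obtain ⟨L, hL, hb⟩ := hf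
  have hA : HasFDerivAt (fun w : ℂ => r • (w - c)) (r • ContinuousLinearMap.id ℝ ℂ) z :=
    ((hasFDerivAt_id z).sub_const c).const_smul r
  refine ⟨_, ((hL.comp z hA).const_smul s).const_add c, fun h => ?_⟩
  have e : ∀ h, (s • L.comp (r • ContinuousLinearMap.id ℝ ℂ)) h = ((s * r : ℝ) : ℂ) * L h := by
    intro h
    simp [mul_assoc]
  simp only [e, norm_mul, Complex.norm_real, Complex.re_ofReal_mul, Complex.im_ofReal_mul, mul_pow,
    Real.norm_eq_abs, sq_abs]
  nlinarith [mul_le_mul_of_nonneg_left (hb h) (sq_nonneg (s * r))]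

/-- With t = 1/K - 1, the derivative stretches tangentially by κ and radially by κ(1+t) = κ/K. Hence
its norm squared is κ² and its determinant κ²/K, giving equality in ‖Df‖² ≤ K det Df. -/
theorem qcAt_radial (hK : 1 ≤ K) {R : ℝ} (hR : 0 < R) (hz : z ≠ 0) :
    QCAt K (fun w => ((‖w‖ / R) ^ (K⁻¹ - 1) : ℝ) • w) z := by
  have hK0 : 0 < K := by linarith
  have hz' : 0 < ‖z‖ := norm_pos_iff.2 hz
  set t := K⁻¹ - 1 with ht
  have ht0 : t ≤ 0 := by
    have := inv_le_one_of_one_le₀ hK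
    linarith
  have ht1 : 0 < 1 + t := by
    have := inv_pos.2 hK0
    linarith
  have hKt : K * (1 + t) = 1 := by rw [ht]; field_simp; ring
  -- The squared norm has a convenient derivative, so the power is rewritten in terms of it.
  have hfun : ∀ w : ℂ, (‖w‖ / R) ^ t = (‖w‖ ^ 2 / R ^ 2) ^ (t / 2) := by
    intro w
    rw [← div_pow, ← Real.rpow_two, ← Real.rpow_mul (by positivity)]
    congr 1
    ring
  simp only [hfun]
  have hn := (hasStrictFDerivAt_norm_sq z).hasFDerivAt
  have hn2 := ((hn.mul_const (R ^ 2)⁻¹).rpow_const (p := t / 2)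
    (Or.inl (by positivity))).smul (hasFDerivAt_id z)
  set κ : ℝ := (‖z‖ ^ 2 * (R ^ 2)⁻¹) ^ (t / 2) with hκ
  have hL : ∀ L : ℂ →L[ℝ] ℂ, (∀ h : ℂ, L h = (κ : ℂ) *
      (h + (t * (z.re * h.re + z.im * h.im) / (z.re ^ 2 + z.im ^ 2) : ℝ) * z)) → ∀ h : ℂ,
      ‖L h‖ ^ 2 ≤ K * ((L 1).re * (L Complex.I).im - (L 1).im * (L Complex.I).re) * ‖h‖ ^ 2 := by
    intro L hL h
    have hn0 : 0 < z.re ^ 2 + z.im ^ 2 := by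
      have := Complex.sq_norm z
      rw [Complex.normSq_apply] at this
      nlinarith [pow_pos hz' 2]
    have hJ : (L 1).re * (L Complex.I).im - (L 1).im * (L Complex.I).re = κ ^ 2 * (1 + t) := by
      simp only [hL, Complex.re_ofReal_mul, Complex.im_ofReal_mul, Complex.add_re, Complex.add_im,
        Complex.one_re, Complex.one_im, Complex.I_re, Complex.I_im]
      field_simp
      ring
    rw [hJ, show K * (κ ^ 2 * (1 + t)) = κ ^ 2 * (K * (1 + t)) by ring, hKt, mul_one, hL,
      norm_mul, mul_pow, Complex.norm_real, Real.norm_eq_abs, sq_abs]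
    refine mul_le_mul_of_nonneg_left ?_ (sq_nonneg κ)
    rw [Complex.sq_norm, Complex.sq_norm, Complex.normSq_apply, Complex.normSq_apply]
    simp only [Complex.add_re, Complex.add_im, Complex.re_ofReal_mul, Complex.im_ofReal_mul]
    set u := (z.re * h.re + z.im * h.im) / (z.re ^ 2 + z.im ^ 2) with hu
    have hu' : u * (z.re ^ 2 + z.im ^ 2) = z.re * h.re + z.im * h.im := by
      rw [hu]; field_simp
    rw [show t * (z.re * h.re + z.im * h.im) / (z.re ^ 2 + z.im ^ 2) = t * u by rw [hu]; ring]
    have : t * (2 + t) * (u ^ 2 * (z.re ^ 2 + z.im ^ 2)) ≤ 0 :=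
      mul_nonpos_of_nonpos_of_nonneg (by nlinarith) (by positivity)
    have e : u * (z.re * h.re + z.im * h.im) = u ^ 2 * (z.re ^ 2 + z.im ^ 2) := by
      rw [← hu']; ring
    nlinarith
  refine ⟨_, hn2, hL _ fun h => ?_⟩
  have hn0 : ‖z‖ ^ 2 = z.re ^ 2 + z.im ^ 2 := by
    rw [Complex.sq_norm, Complex.normSq_apply]; ring
  have e1 : (‖z‖ ^ 2 * (R ^ 2)⁻¹) ^ (t / 2 - 1) = κ / (‖z‖ ^ 2 * (R ^ 2)⁻¹) := by
    rw [Real.rpow_sub (by positivity), Real.rpow_one]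
  simp [e1, Complex.inner]
  have hz2 : (‖z‖ : ℂ) ^ 2 ≠ 0 := by exact_mod_cast (pow_pos hz' 2).ne'
  have hR2 : (R : ℂ) ≠ 0 := by exact_mod_cast hR.ne'
  have hn1 : ((z.re : ℂ) ^ 2 + (z.im : ℂ) ^ 2) = (‖z‖ : ℂ) ^ 2 := by exact_mod_cast hn0.symm
  rw [hn1]
  field_simp

theorem ae_comp_affine {Q : ℂ → Prop} (hQ : ∀ᵐ z, Q z) (c : ℂ) {r : ℝ} (hr : r ≠ 0) :
    ∀ᵐ z, Q (r⁻¹ • (z - c)) := by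
  rw [ae_iff] at hQ ⊢
  have h := volume_image_add_smul c r {z | ¬ Q z}
  rw [hQ, mul_zero] at h
  refine measure_mono_null ?_ h
  intro z hz
  refine ⟨r⁻¹ • (z - c), hz, ?_⟩
  simp only
  rw [smul_inv_smul₀ hr]
  ring

theorem ae_norm_sub_ne (c : ℂ) (r : ℝ) : ∀ᵐ z, ‖z - c‖ ≠ r := by
  rw [ae_iff]
  refine measure_mono_null (fun z hz => ?_) (Measure.addHaar_sphere volume c r)
  rw [mem_sphere_iff_norm]
  simpa using hz

/-- Away from finitely many circles, which are null, the glued map is locally the identity, a power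
map, or a rescaled copy of ψ. -/
theorem ae_qcAt_glueDisks (hK : 1 ≤ K) {P : DiskPacking} {a : ℝ} (ha : 1 ≤ a) {ψ : ℂ → ℂ}
    (hψ : IsDiskMap ψ) (hq : ∀ᵐ z, QCAt K ψ z) : ∀ᵐ z, QCAt K (glueDisks P a K⁻¹ ψ) z := by
  have h1 : ∀ᵐ z, ∀ p ∈ (P.disks : Set (ℂ × ℝ)), ‖z - p.1‖ ≠ p.2 ∧ ‖z - p.1‖ ≠ p.2 ^ a ∧
      QCAt K ψ ((p.2 ^ a : ℝ)⁻¹ • (z - p.1)) := by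
    rw [ae_ball_iff P.disks.countable_toSet]
    intro p hp
    filter_upwards [ae_norm_sub_ne p.1 p.2, ae_norm_sub_ne p.1 (p.2 ^ a),
      ae_comp_affine hq p.1 (Real.rpow_pos_of_pos (P.pos p hp) a).ne'] with z h1 h2 h3
    exact ⟨h1, h2, h3⟩
  filter_upwards [h1] with z hz
  have hcont : ∀ c : ℂ, Continuous fun w : ℂ => ‖w - c‖ := fun c => by fun_prop
  by_cases h : ∃ p ∈ P.disks, ‖z - p.1‖ ≤ p.2
  · obtain ⟨p, hp, h⟩ := h
    obtain ⟨n1, n2, n3⟩ := hz p hp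
    have hR := P.pos p hp
    have haR := P.rpow_le ha hp
    have hev : ∀ᶠ w in 𝓝 z, ‖w - p.1‖ < p.2 :=
      (hcont p.1).continuousAt.eventually_lt_const (lt_of_le_of_ne h n1)
    rcases lt_or_gt_of_ne n2 with h' | h'
    · have hev2 : ∀ᶠ w in 𝓝 z, ‖w - p.1‖ < p.2 ^ a :=
        (hcont p.1).continuousAt.eventually_lt_const h'
      refine (n3.comp_affine (c := p.1) (s := p.2 ^ (1 + K⁻¹ * (a - 1)))).congr ?_
      filter_upwards [hev, hev2] with w hw hw2
      rw [glueDisks_of_mem hψ ha hp hw.le, diskMap_of_le hψ hR haR hw2.le]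
    · have hev2 : ∀ᶠ w in 𝓝 z, p.2 ^ a < ‖w - p.1‖ :=
        (hcont p.1).continuousAt.eventually_const_lt h'
      have h0 : z - p.1 ≠ 0 := by
        intro h0
        rw [h0, norm_zero] at h'
        exact absurd h' (not_lt.2 (Real.rpow_nonneg hR.le a))
      have hq := qcAt_radial hK hR h0
      rw [← one_smul ℝ (z - p.1)] at hq
      refine (hq.comp_affine (c := p.1) (s := 1)).congr ?_
      filter_upwards [hev, hev2] with w hw hw2
      rw [glueDisks_of_mem hψ ha hp hw.le, diskMap_of_ge hψ hR hw2.le,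
        radialStretch_of_mem hw2.le hw.le, one_smul, one_smul]
  · push Not at h
    refine (qcAt_id hK).congr ?_
    have hev : ∀ᶠ w in 𝓝 z, ∀ p ∈ P.disks, p.2 < ‖w - p.1‖ := by
      rw [Filter.eventually_all_finset]
      exact fun p hp => (hcont p.1).continuousAt.eventually_const_lt (h p hp)
    filter_upwards [hev] with w hw
    exact glueDisks_eq_self hψ ha fun p hp => (hw p hp).le

theorem ae_qcAt_stageMap (hK : 1 ≤ K) (P : ℕ → DiskPacking) {a : ℝ} (ha : 1 ≤ a) (N k : ℕ) :
    ∀ᵐ z, QCAt K (stageMap P a K⁻¹ N k) z := by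
  induction N generalizing k with
  | zero => exact Eventually.of_forall fun z => qcAt_id hK
  | succ N ih =>
    exact ae_qcAt_glueDisks hK ha (isDiskMap_stageMap P ha (by positivity) N (k + 1)) (ih (k + 1))

/-- Let A be the derivative in direction β and B the one perpendicular to it, so the Jacobian is at
most |A||B|. Then |B|² ≤ K|A||B| gives |B| ≤ K|A|, and any directional derivative X satisfies |X|² ≤
K|A||B| ≤ K²|A|². -/
theorem norm_le_mul_norm_of_sq_le {p q : ℂ}
    (h : ∀ c s : ℝ, ‖c * p + s * q‖ ^ 2 ≤
      K * (p.re * q.im - p.im * q.re) * (c ^ 2 + s ^ 2)) (hK : 0 < K) (α β : ℝ) :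
    ‖(Real.cos α : ℂ) * p + (Real.sin α : ℂ) * q‖ ≤
      K * ‖(Real.cos β : ℂ) * p + (Real.sin β : ℂ) * q‖ := by
  have h1 := h (Real.cos α) (Real.sin α)
  have h2 := h (-Real.sin β) (Real.cos β)
  rw [Real.cos_sq_add_sin_sq, mul_one] at h1
  rw [neg_sq, Real.sin_sq_add_cos_sq, mul_one] at h2
  set X := (Real.cos α : ℂ) * p + (Real.sin α : ℂ) * q
  set A := (Real.cos β : ℂ) * p + (Real.sin β : ℂ) * q with hA
  set B := ((-Real.sin β : ℝ) : ℂ) * p + (Real.cos β : ℂ) * q with hB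
  have hJ : p.re * q.im - p.im * q.re = A.re * B.im - A.im * B.re := by
    simp only [hA, hB, Complex.add_re, Complex.add_im, Complex.re_ofReal_mul,
      Complex.im_ofReal_mul]
    linear_combination (-(p.re * q.im - p.im * q.re)) * Real.cos_sq_add_sin_sq β
  have hJ2 : A.re * B.im - A.im * B.re ≤ ‖A‖ * ‖B‖ := by
    have e : A.re * B.im - A.im * B.re = ((starRingEnd ℂ) A * B).im := by
      simp; ring
    rw [e]
    refine (Complex.im_le_norm _).trans ?_
    rw [norm_mul, RCLike.norm_conj]
  rw [hJ] at h1 h2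
  have h3 : K * (A.re * B.im - A.im * B.re) ≤ K * (‖A‖ * ‖B‖) := by gcongr
  have hA0 := norm_nonneg A
  have hBA : ‖B‖ ≤ K * ‖A‖ := by
    rcases (norm_nonneg B).eq_or_lt with hB0 | hB0
    · rw [← hB0]; positivity
    · nlinarith
  refine abs_le_of_sq_le_sq' ?_ (by positivity) |>.2
  nlinarith [mul_le_mul_of_nonneg_left hBA (mul_nonneg hK.le hA0)]

end QCAt

/-! ### Weak derivatives and energy bounds -/

theorem IsL2Loc.locallyIntegrable {f : ℂ → ℂ} (hf : IsL2Loc f) : LocallyIntegrable f volume := by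
  rw [locallyIntegrable_iff]
  intro C hC
  have : IsFiniteMeasure (volume.restrict C) := ⟨by simpa using hC.measure_lt_top⟩
  exact (hf C hC).integrable (by norm_num)

theorem Continuous.isL2Loc {f : ℂ → ℂ} (hf : Continuous f) : IsL2Loc f := by
  intro C hC
  have : IsFiniteMeasure (volume.restrict C) := ⟨by simpa using hC.measure_lt_top⟩
  obtain ⟨M, hM⟩ := hC.exists_bound_of_continuousOn hf.continuousOn
  refine MemLp.of_bound hf.aestronglyMeasurable M ?_
  exact (ae_restrict_iff' hC.measurableSet).2 (Eventually.of_forall hM)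

/-- Integration by parts for real Lipschitz functions is applied to the real and imaginary parts;
Rademacher's theorem identifies their line derivatives almost everywhere with those parts of the
derivative of f. -/
theorem LipschitzWith.isWeakPartial_lineDeriv {f : ℂ → ℂ} {C : NNReal} (hf : LipschitzWith C f)
    (v : ℂ) (hloc : IsL2Loc fun z => lineDeriv ℝ f z v) :
    IsWeakPartial v f fun z => lineDeriv ℝ f z v := by
  intro ψ hψ hψc
  obtain ⟨D, hD⟩ := ContDiff.lipschitzWith_of_hasCompactSupport hψc hψ (by simp)
  have hcont : Continuous fun z => fderiv ℝ ψ z v :=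
    (hψ.continuous_fderiv (by simp)).clm_apply continuous_const
  have hcs : HasCompactSupport fun z => fderiv ℝ ψ z v := hψc.fderiv_apply (𝕜 := ℝ) v
  have hi1 : Integrable fun z => (fderiv ℝ ψ z v) • f z :=
    (hcont.smul hf.continuous).integrable_of_hasCompactSupport hcs.smul_right
  have hi2 : Integrable fun z => ψ z • lineDeriv ℝ f z v :=
    hloc.locallyIntegrable.integrable_smul_left_of_hasCompactSupport hψ.continuous hψc
  have key : ∀ (T : ℂ →L[ℝ] ℝ) (E : NNReal), LipschitzWith E (fun z => T (f z)) →
      T (∫ z, (fderiv ℝ ψ z v) • f z) = T (- ∫ z, ψ z • lineDeriv ℝ f z v) := by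
    intro T E hT
    rw [map_neg, ← T.integral_comp_comm hi1, ← T.integral_comp_comm hi2]
    have h := hT.integral_lineDeriv_mul_eq (μ := volume) hD hψc v
    have e1 : ∫ z, lineDeriv ℝ (fun z => T (f z)) z v * ψ z =
        ∫ z, T (ψ z • lineDeriv ℝ f z v) := by
      refine integral_congr_ae ?_
      filter_upwards [hf.ae_differentiableAt (μ := volume)] with z hz
      have h1 := ((T.hasFDerivAt.comp z hz.hasFDerivAt).hasLineDerivAt v).lineDeriv
      change lineDeriv ℝ (T ∘ f) z v * ψ z = _
      rw [h1, (hz.hasFDerivAt.hasLineDerivAt v).lineDeriv]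
      rw [map_smul, smul_eq_mul, mul_comm, ContinuousLinearMap.comp_apply]
    have e2 : ∫ z, lineDeriv ℝ ψ z (-v) * T (f z) = - ∫ z, T ((fderiv ℝ ψ z v) • f z) := by
      rw [← integral_neg]
      refine integral_congr_ae (Eventually.of_forall fun z => ?_)
      have hz : DifferentiableAt ℝ ψ z := hψ.differentiable (by simp) z
      simp only
      rw [(hz.hasFDerivAt.hasLineDerivAt (-v)).lineDeriv, map_smul, map_neg, smul_eq_mul, neg_mul]
    rw [e1, e2] at h
    rw [h, neg_neg]
  refine Complex.ext ?_ ?_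
  · exact key Complex.reCLM _ (Complex.reCLM.lipschitz.comp hf)
  · exact key Complex.imCLM _ (Complex.imCLM.lipschitz.comp hf)

/-- Weak derivatives pass to a uniform limit if they agree with the limit function outside sets of
vanishing area, with bounded `L²` distance. -/
theorem IsWeakPartial.of_tendstoUniformly {v : ℂ} {f : ℕ → ℂ → ℂ} {φ : ℂ → ℂ} {g : ℕ → ℂ → ℂ}
    {p : ℂ → ℂ} (hf : ∀ N, Continuous (f N)) (hφ : Continuous φ)
    (hunif : TendstoUniformly f φ atTop) (hw : ∀ N, IsWeakPartial v (f N) (g N))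
    (hg : ∀ N, IsL2Loc (g N)) (hp : IsL2Loc p) {B : ℕ → Set ℂ}
    (hvol : Tendsto (fun N => volume (B N)) atTop (𝓝 0)) (heq : ∀ N, ∀ z ∉ B N, g N z = p z)
    {C : ℝ≥0∞} (hC : C ≠ ⊤)
    (hbd : ∀ N, eLpNorm (g N - p) 2 (volume.restrict (B N)) ≤ C) : IsWeakPartial v φ p := by
  intro ψ hψ hψc
  have hcont : Continuous fun z => fderiv ℝ ψ z v :=
    (hψ.continuous_fderiv (by simp)).clm_apply continuous_const
  have hcs : HasCompactSupport fun z => fderiv ℝ ψ z v := hψc.fderiv_apply (𝕜 := ℝ) v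
  have h1 : Tendsto (fun N => ∫ z, (fderiv ℝ ψ z v) • f N z) atTop
      (𝓝 (∫ z, (fderiv ℝ ψ z v) • φ z)) := by
    refine tendsto_integral_filter_of_dominated_convergence
      (fun z => ‖fderiv ℝ ψ z v‖ * (‖φ z‖ + 1)) ?_ ?_ ?_ ?_
    · exact Eventually.of_forall fun N => (hcont.smul (hf N)).aestronglyMeasurable
    · filter_upwards [Metric.tendstoUniformly_iff.1 hunif 1 one_pos] with N hN
      refine Eventually.of_forall fun z => ?_
      rw [norm_smul]
      refine mul_le_mul_of_nonneg_left ?_ (norm_nonneg _)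
      have h1 := hN z
      rw [dist_comm, dist_eq_norm] at h1
      have h2 := norm_sub_norm_le (f N z) (φ z)
      linarith
    · exact (hcont.norm.mul (hφ.norm.add continuous_const)).integrable_of_hasCompactSupport
        hcs.norm.mul_right
    · exact Eventually.of_forall fun z => (hunif.tendsto_at z).const_smul _
  obtain ⟨M, hM⟩ := hψc.exists_bound_of_continuous hψ.continuous
  have hint : ∀ q : ℂ → ℂ, IsL2Loc q → Integrable fun z => ψ z • q z := fun q hq =>
    hq.locallyIntegrable.integrable_smul_left_of_hasCompactSupport hψ.continuous hψc
  have hmeas : ∀ q : ℂ → ℂ, IsL2Loc q → AEStronglyMeasurable q volume := fun q hq =>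
    hq.locallyIntegrable.aestronglyMeasurable
  have h2 : Tendsto (fun N => ∫ z, ψ z • g N z) atTop (𝓝 (∫ z, ψ z • p z)) := by
    refine tendsto_integral_of_L1' _ (hint p hp).aestronglyMeasurable (Eventually.of_forall fun N => hint _ (hg N)) ?_
    -- The difference lives on B N, so Cauchy–Schwarz bounds its L¹ norm by the bounded L² norm
    -- times |B N|^(1/2), which tends to 0.
    have hle : ∀ N, eLpNorm ((fun z => ψ z • g N z) - fun z => ψ z • p z) 1 volume ≤
        ENNReal.ofReal M * (C * volume (B N) ^ (1 / 2 : ℝ)) := by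
      intro N
      have e : ((fun z => ψ z • g N z) - fun z => ψ z • p z) = fun z => ψ z • (g N - p) z := by
        ext z
        simp [mul_sub]
      rw [e, ← eLpNorm_restrict_eq_of_support_subset (s := B N)]
      · calc _ ≤ ENNReal.ofReal M * eLpNorm (g N - p) 1 (volume.restrict (B N)) := by
              refine eLpNorm_le_mul_eLpNorm_of_ae_le_mul (Eventually.of_forall fun z => ?_) 1
              rw [norm_smul]
              exact mul_le_mul_of_nonneg_right (hM z) (norm_nonneg _)
          _ ≤ _ := by
              gcongr
              refine (eLpNorm_le_eLpNorm_mul_rpow_measure_univ (q := 2) (by norm_num)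
                ((hmeas _ (hg N)).sub (hmeas _ hp)).restrict).trans ?_
              rw [Measure.restrict_apply_univ]
              refine mul_le_mul' (hbd N) (le_of_eq ?_)
              norm_num
      · intro z hz
        by_contra hzB
        refine hz ?_
        simp [heq N z hzB]
    refine tendsto_of_tendsto_of_tendsto_of_le_of_le tendsto_const_nhds ?_
      (fun _ => zero_le) hle
    have h3 : Tendsto (fun N => volume (B N) ^ (1 / 2 : ℝ)) atTop (𝓝 0) := by
      have := ((ENNReal.continuous_rpow_const (y := (1 / 2 : ℝ))).tendsto 0).comp hvol
      rwa [ENNReal.zero_rpow_of_pos (by norm_num)] at this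
    have h4 := ENNReal.Tendsto.const_mul (a := C) h3 (Or.inr hC)
    have h5 := ENNReal.Tendsto.const_mul (a := ENNReal.ofReal M) h4 (Or.inr ENNReal.ofReal_ne_top)
    simpa using h5
  have h3 := h2.neg
  refine tendsto_nhds_unique h1 (h3.congr fun N => ?_)
  exact (hw N ψ hψ hψc).symm

/-- Energy estimate for injective maps of bounded distortion. -/
theorem eLpNorm_lineDeriv_le {K : ℝ} (hK : 0 ≤ K) {f : ℂ → ℂ} (hinj : Function.Injective f)
    (hq : ∀ᵐ z, QCAt K f z) {v : ℂ} (hv : ‖v‖ ≤ 1) {A : Set ℂ} (hA : MeasurableSet A) :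
    eLpNorm (fun z => lineDeriv ℝ f z v) 2 (volume.restrict A) ≤
      (ENNReal.ofReal K * volume (f '' A)) ^ (1 / 2 : ℝ) := by
  rw [eLpNorm_eq_lintegral_rpow_enorm_toReal (by norm_num) (by norm_num)]
  simp only [ENNReal.toReal_ofNat]
  refine ENNReal.rpow_le_rpow ?_ (by norm_num)
  -- The change of variables needs differentiability at every point, so A is first cut down to S,
  -- losing only a null set.
  set S := {z | DifferentiableAt ℝ f z} with hS
  have hSm : MeasurableSet S := measurableSet_of_differentiableAt ℝ f
  have hres : volume.restrict A = volume.restrict (A ∩ S) := by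
    refine Measure.restrict_congr_set (Filter.eventuallyEq_set.2 ?_)
    filter_upwards [hq] with z hz
    obtain ⟨L, hL, -⟩ := hz
    exact ⟨fun h => ⟨h, hL.differentiableAt⟩, fun h => h.1⟩
  have hle : ∀ᵐ z, ‖lineDeriv ℝ f z v‖ₑ ^ (2 : ℝ) ≤
      ENNReal.ofReal K * ENNReal.ofReal |(fderiv ℝ f z).det| := by
    filter_upwards [hq] with z hz
    obtain ⟨L, hL, hb⟩ := hz
    rw [hL.fderiv, (hL.hasLineDerivAt v).lineDeriv, L.det_complex, ← ENNReal.ofReal_mul hK,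
      ← ofReal_norm, ENNReal.ofReal_rpow_of_nonneg (norm_nonneg _) (by norm_num),
      Real.rpow_two]
    refine ENNReal.ofReal_le_ofReal ((hb v).trans ?_)
    have h1 : 0 ≤ K * |(L 1).re * (L Complex.I).im - (L 1).im * (L Complex.I).re| := by positivity
    calc _ ≤ K * |(L 1).re * (L Complex.I).im - (L 1).im * (L Complex.I).re| * ‖v‖ ^ 2 := by
          gcongr; exact le_abs_self _
      _ ≤ _ := mul_le_of_le_one_right h1 (pow_le_one₀ (norm_nonneg _) hv)
  calc ∫⁻ z in A, ‖lineDeriv ℝ f z v‖ₑ ^ (2 : ℝ)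
      ≤ ∫⁻ z in A, ENNReal.ofReal K * ENNReal.ofReal |(fderiv ℝ f z).det| :=
        lintegral_mono_ae (ae_restrict_of_ae hle)
    _ = ENNReal.ofReal K * ∫⁻ z in A ∩ S, ENNReal.ofReal |(fderiv ℝ f z).det| := by
        rw [lintegral_const_mul' _ _ ENNReal.ofReal_ne_top, hres]
    _ = ENNReal.ofReal K * volume (f '' (A ∩ S)) := by
        rw [lintegral_abs_det_fderiv_eq_addHaar_image volume (hA.inter hSm)
          (fun z hz => hz.2.hasFDerivAt.hasFDerivWithinAt) hinj.injOn]
    _ ≤ _ := by gcongr; exact inter_subset_left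

theorem isL2Loc_lineDeriv {K : ℝ} (hK : 0 ≤ K) {f : ℂ → ℂ} (hf : Continuous f)
    (hinj : Function.Injective f) (hq : ∀ᵐ z, QCAt K f z) {v : ℂ} (hv : ‖v‖ ≤ 1) :
    IsL2Loc fun z => lineDeriv ℝ f z v := by
  intro C hC
  refine ⟨(measurable_lineDeriv hf).aestronglyMeasurable,
    (eLpNorm_lineDeriv_le hK hinj hq hv hC.measurableSet).trans_lt ?_⟩
  refine ENNReal.rpow_lt_top_of_nonneg (by norm_num) (ENNReal.mul_ne_top ENNReal.ofReal_ne_top ?_)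
  exact (hC.image hf).measure_lt_top.ne

/-! ### Quasiconformality of the limit -/

theorem volume_packingCantor (P : ℕ → DiskPacking) {a : ℝ} (ha : 1 < a) :
    volume (packingCantor P a) = 0 := by
  refine le_antisymm ((volume_le_hausdorffMeasure_two _).trans (le_of_eq ?_)) (zero_le)
  have h : 2 / a < 2 := div_lt_self two_pos ha
  exact (Measure.hausdorffMeasure_zero_or_top h _).resolve_right
    (hausdorffMeasure_packingCantor_lt_top P ha.le).ne

theorem tendsto_volume_cantorStage (P : ℕ → DiskPacking) {a : ℝ} (ha : 1 < a) :
    Tendsto (fun N => volume (cantorStage P a N 0)) atTop (𝓝 0) := by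
  have h := tendsto_measure_iInter_atTop (μ := volume) (s := fun N => cantorStage P a N 0)
    (fun N => (isCompact_cantorStage P a N 0).measurableSet.nullMeasurableSet)
    (antitone_cantorStage P ha.le 0) ⟨0, (isCompact_cantorStage P a 0 0).measure_lt_top.ne⟩
  have h0 := volume_packingCantor P ha
  rw [packingCantor] at h0
  rwa [h0] at h

section cantorMap

variable {K : ℝ} (P : ℕ → DiskPacking) {a : ℝ}

theorem cantorMap_eventuallyEq (hK : 0 < K) (ha : 1 ≤ a) {N : ℕ} {z : ℂ}
    (hz : z ∉ cantorStage P a N 0) : cantorMap P a K⁻¹ =ᶠ[𝓝 z] stageMap P a K⁻¹ N 0 := by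
  filter_upwards [(isCompact_cantorStage P a N 0).isClosed.isOpen_compl.mem_nhds hz] with w hw
  exact cantorMap_eq_stageMap P ha (inv_pos.2 hK) hw

theorem ae_qcAt_cantorMap (hK : 1 ≤ K) (ha : 1 < a) :
    ∀ᵐ z, QCAt K (cantorMap P a K⁻¹) z := by
  have h1 : ∀ᵐ z, z ∉ packingCantor P a := measure_eq_zero_iff_ae_notMem.1 (volume_packingCantor P ha)
  filter_upwards [h1, ae_all_iff.2 fun N => ae_qcAt_stageMap hK P ha.le N 0] with z hz hq
  simp only [packingCantor, mem_iInter, not_forall] at hz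
  obtain ⟨N, hN⟩ := hz
  exact (hq N).congr (cantorMap_eventuallyEq P (by linarith) ha.le hN)

/-- All the maps send the unit disk into itself, so on every stage the energies of the approximant
and of the limit are both at most K times the area of the disk. This is the uniform L² bound
required for the passage to the limit. -/
theorem isWeakPartial_cantorMap (hK : 1 ≤ K) (ha : 1 < a) {v : ℂ} (hv : ‖v‖ ≤ 1) :
    IsWeakPartial v (cantorMap P a K⁻¹) fun z => lineDeriv ℝ (cantorMap P a K⁻¹) z v := by
  have hK0 : 0 < K := by linarith
  have hθ : 0 < K⁻¹ := inv_pos.2 hK0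
  have hc : ∀ N, Continuous (stageMap P a K⁻¹ N 0) := fun N =>
    (isDiskMap_stageMap P ha.le hθ N 0).continuous
  have hinj : ∀ N, Function.Injective (stageMap P a K⁻¹ N 0) := fun N =>
    Function.LeftInverse.injective (stageMap_inverse P ha.le hθ N 0)
  have hcφ := continuous_cantorMap P ha.le hθ
  have hinjφ := (isHomeomorph_cantorMap P ha.le hθ).injective
  have hL2 := fun N => isL2Loc_lineDeriv hK0.le (hc N) (hinj N) (ae_qcAt_stageMap hK P ha.le N 0) hv
  have hBm := fun N => (isCompact_cantorStage P a N 0).measurableSet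
  set V := volume (Metric.closedBall (0 : ℂ) 1) with hV
  have hbound : ∀ N {f : ℂ → ℂ}, (∀ z, ‖z‖ ≤ 1 → ‖f z‖ ≤ 1) →
      (ENNReal.ofReal K * volume (f '' cantorStage P a N 0)) ^ (1 / 2 : ℝ) ≤
        (ENNReal.ofReal K * V) ^ (1 / 2 : ℝ) := by
    intro N f hf
    gcongr
    refine measure_mono ?_
    rintro _ ⟨z, hz, rfl⟩
    simpa using hf z (by simpa using cantorStage_subset_closedBall P ha.le N 0 hz)
  have hφle : ∀ z, ‖z‖ ≤ 1 → ‖cantorMap P a K⁻¹ z‖ ≤ 1 := fun z hz =>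
    le_of_tendsto' (tendsto_stageMap P ha.le hθ z).norm fun N =>
      (isDiskMap_stageMap P ha.le hθ N 0).norm_le z hz
  refine IsWeakPartial.of_tendstoUniformly hc hcφ (tendstoUniformly_stageMap P ha.le hθ)
    (g := fun N z => lineDeriv ℝ (stageMap P a K⁻¹ N 0) z v) (fun N => ?_) hL2
    (isL2Loc_lineDeriv hK0.le hcφ hinjφ (ae_qcAt_cantorMap P hK ha) hv)
    (tendsto_volume_cantorStage P ha) (fun N z hz => ?_)
    (C := (ENNReal.ofReal K * V) ^ (1 / 2 : ℝ) + (ENNReal.ofReal K * V) ^ (1 / 2 : ℝ)) ?_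
    fun N => ?_
  · obtain ⟨C, hC⟩ := exists_lipschitzWith_stageMap P (θ := K⁻¹) ha.le N 0
    exact hC.isWeakPartial_lineDeriv v (hL2 N)
  · exact ((cantorMap_eventuallyEq P hK0 ha.le hz).lineDeriv_eq).symm
  · have : (ENNReal.ofReal K * V) ^ (1 / 2 : ℝ) ≠ ⊤ :=
      ENNReal.rpow_ne_top_of_nonneg (by norm_num) (ENNReal.mul_ne_top ENNReal.ofReal_ne_top
        (isCompact_closedBall _ _).measure_lt_top.ne)
    exact ENNReal.add_ne_top.2 ⟨this, this⟩
  · refine (eLpNorm_sub_le (measurable_lineDeriv (hc N)).aestronglyMeasurable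
      (measurable_lineDeriv hcφ).aestronglyMeasurable (by norm_num)).trans (add_le_add ?_ ?_)
    · exact (eLpNorm_lineDeriv_le hK0.le (hinj N) (ae_qcAt_stageMap hK P ha.le N 0) hv
        (hBm N)).trans (hbound N (isDiskMap_stageMap P ha.le hθ N 0).norm_le)
    · exact (eLpNorm_lineDeriv_le hK0.le hinjφ (ae_qcAt_cantorMap P hK ha) hv
        (hBm N)).trans (hbound N hφle)

theorem isQuasiconformal_cantorMap (hK : 1 ≤ K) (ha : 1 < a) :
    IsQuasiconformal K (cantorMap P a K⁻¹) := by
  have hK0 : 0 < K := by linarith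
  have hθ : 0 < K⁻¹ := inv_pos.2 hK0
  have hcφ := continuous_cantorMap P ha.le hθ
  have hhom := isHomeomorph_cantorMap P ha.le hθ
  have hq := ae_qcAt_cantorMap P hK ha
  have hI : ‖Complex.I‖ ≤ 1 := by simp
  have h1 : ‖(1 : ℂ)‖ ≤ 1 := by simp
  have hform : ∀ (L : ℂ →L[ℝ] ℂ) (c s : ℝ), (c : ℂ) * L 1 + s * L Complex.I =
      L (c + s * Complex.I) := by
    intro L c s
    have e : (c + s * Complex.I : ℂ) = c • (1 : ℂ) + s • Complex.I := by simp
    rw [e, map_add, map_smul, map_smul]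
    simp
  refine ⟨hhom, hcφ.isL2Loc, fun z => lineDeriv ℝ (cantorMap P a K⁻¹) z 1,
    fun z => lineDeriv ℝ (cantorMap P a K⁻¹) z Complex.I, isWeakPartial_cantorMap P hK ha h1,
    isWeakPartial_cantorMap P hK ha hI, isL2Loc_lineDeriv hK0.le hcφ hhom.injective hq h1,
    isL2Loc_lineDeriv hK0.le hcφ hhom.injective hq hI, ?_, ?_⟩
  · filter_upwards [hq] with z hz
    obtain ⟨L, hL, hb⟩ := hz
    simp only [(hL.hasLineDerivAt _).lineDeriv]
    refine norm_le_mul_norm_of_sq_le (fun c s => ?_) hK0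
    rw [hform]
    refine (hb _).trans (le_of_eq ?_)
    rw [Complex.sq_norm, Complex.normSq_add_mul_I]
  · filter_upwards [hq] with z hz
    obtain ⟨L, hL, hb⟩ := hz
    simp only [(hL.hasLineDerivAt _).lineDeriv]
    have h := (sq_nonneg _).trans (hb 1)
    rw [norm_one, one_pow, mul_one] at h
    exact nonneg_of_mul_nonneg_right h hK0

end cantorMap

/-! ### Gauge functions and the extremal pair -/

/-- At small scales g(t) ≤ ε t^d, so the g-measure is at most ε times the finite d-measure, for
every ε > 0. -/
theorem gaugeHausdorff_eq_zero {d : ℝ} (hd : 0 < d) {g : ℝ → ℝ} (hg : IsGauge g)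
    (hdg : GaugePrec (fun t => t ^ d) g) {E : Set ℂ} (hE : μH[d] E ≠ ⊤) :
    gaugeHausdorff g E = 0 := by
  -- Covers may contain balls of radius 0, so the comparison is also needed at t = 0, where the
  -- limit of g(t)/t^d says nothing.
  have hg0 : g 0 = 0 := by
    have h := (hg.continuousOn 0 self_mem_Ici).mono_left (nhdsWithin_mono 0 Ioi_subset_Ici_self)
    exact tendsto_nhds_unique h hg.tendsto_zero
  have hfin : gaugeHausdorff (fun t => t ^ d) E ≠ ⊤ :=
    ((gaugeHausdorff_le_hausdorffMeasure d hd E).trans_lt (ENNReal.mul_lt_top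
      (ENNReal.rpow_lt_top_of_nonneg hd.le (by simp)) hE.lt_top)).ne
  have key : ∀ ε : ℝ, 0 < ε →
      gaugeHausdorff g E ≤ ENNReal.ofReal ε * gaugeHausdorff (fun t => t ^ d) E := by
    intro ε hε
    obtain ⟨η, hη, hη'⟩ := mem_nhdsGT_iff_exists_Ioo_subset.1 (hdg.eventually_lt_const hε)
    have hle : ∀ t, 0 ≤ t → t < η → g t ≤ ε * t ^ d := by
      intro t ht htη
      rcases ht.eq_or_lt with rfl | ht
      · rw [hg0, Real.zero_rpow hd.ne', mul_zero]
      · have h : g t / t ^ d < ε := hη' ⟨ht, htη⟩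
        exact ((div_lt_iff₀ (Real.rpow_pos_of_pos ht d)).1 h).le
    refine iSup₂_le fun δ hδ => ?_
    refine le_trans ?_ (mul_le_mul_right (le_iSup₂ (α := ℝ≥0∞) (min δ η) (lt_min hδ hη)) _)
    simp only [ENNReal.mul_iInf_of_ne (ENNReal.ofReal_pos.2 hε).ne' ENNReal.ofReal_ne_top]
    refine le_iInf fun z => le_iInf fun r => le_iInf fun hr => le_iInf fun hF => ?_
    refine iInf_le_of_le z (iInf_le_of_le r (iInf_le_of_le
      (fun j => ⟨(hr j).1, (hr j).2.trans_le (min_le_left _ _)⟩) (iInf_le_of_le hF ?_)))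
    rw [← ENNReal.tsum_mul_left]
    refine ENNReal.tsum_le_tsum fun j => ?_
    rw [← ENNReal.ofReal_mul hε.le]
    exact ENNReal.ofReal_le_ofReal (hle _ (by linarith [(hr j).1])
      ((hr j).2.trans_le (min_le_right _ _)))
  refine le_antisymm (le_of_forall_gt fun c hc => ?_) zero_le
  have hlim : Tendsto (fun ε : ℝ => ENNReal.ofReal ε * gaugeHausdorff (fun t => t ^ d) E)
      (𝓝[>] 0) (𝓝 0) := by
    have h1 : Tendsto (fun ε : ℝ => ENNReal.ofReal ε) (𝓝[>] 0) (𝓝 0) := by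
      simpa using (ENNReal.tendsto_ofReal (tendsto_id (x := 𝓝 (0 : ℝ)))).mono_left
        (nhdsWithin_le_nhds (s := Ioi 0))
    simpa using ENNReal.Tendsto.mul_const h1 (Or.inr hfin)
  obtain ⟨ε, hε1, hε2⟩ := ((hlim.eventually_lt_const hc).and self_mem_nhdsWithin).exists
  exact (key ε hε2).trans_lt hε1

/-- Compact sets realizing extremal distortion of Hausdorff measure. -/
theorem exists_extremal_pair {K d : ℝ} (hK : 1 ≤ K) (hd0 : 0 < d) (hd2 : d < 2) :
    ∃ (E : Set ℂ) (φ : ℂ → ℂ), IsCompact E ∧ IsQuasiconformal K φ ∧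
      0 < μH[d] E ∧ μH[d] E < ⊤ ∧
      0 < μH[2 * K * d / (2 + (K - 1) * d)] (φ '' E) ∧
      μH[2 * K * d / (2 + (K - 1) * d)] (φ '' E) < ⊤ := by
  have hK0 : 0 < K := by linarith
  obtain ⟨a, rfl, ha⟩ : ∃ a, d = 2 / a ∧ 1 < a :=
    ⟨2 / d, by field_simp, (one_lt_div hd0).2 hd2⟩
  have ha0 : 0 < a := by linarith
  set b := 1 + K⁻¹ * (a - 1) with hb
  have hKinv : 0 < K⁻¹ := inv_pos.2 hK0
  have hb1 : 1 < b := by nlinarith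
  have hba : b ≤ a := by
    have := inv_le_one_of_one_le₀ hK
    nlinarith
  have hd' : 2 * K * (2 / a) / (2 + (K - 1) * (2 / a)) = 2 / b := by
    have h1 : 2 + (K - 1) * (2 / a) ≠ 0 := by
      have : 0 ≤ (K - 1) * (2 / a) := mul_nonneg (by linarith) (by positivity)
      linarith
    have h2 : b ≠ 0 := by linarith
    rw [div_eq_div_iff h1 h2, hb]
    field_simp
    ring
  have hex : ∀ k : ℕ, ∃ P : DiskPacking, (∀ p ∈ P.disks,
      -- The second bound is equivalent to R^(b-1) ≤ 1/2, that is R^b ≤ R/2, the separation required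
      -- for positivity at exponent b; since a ≥ b it holds at exponent a as well.
      p.2 ≤ min (1 / 2) ((1 / 2 : ℝ) ^ (1 / (b - 1)))) ∧
      1 - 1 / ((k : ℝ) + 2) ^ 2 ≤ ∑ p ∈ P.disks, p.2 ^ 2 := fun k =>
    DiskPacking.exists_packing (lt_min (by norm_num) (by positivity)) (min_le_left _ _)
      (by positivity)
  choose P hP1 hP2 using hex
  have hPb : ∀ k, ∀ p ∈ (P k).disks, p.2 ^ b ≤ p.2 / 2 := by
    intro k p hp
    have h0 := (P k).pos p hp
    have h1 := (hP1 k p hp).trans (min_le_right _ _)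
    have hb0 : 0 < b - 1 := by linarith
    have h2 : p.2 ^ (b - 1) ≤ 1 / 2 := by
      refine (Real.rpow_le_rpow h0.le h1 hb0.le).trans (le_of_eq ?_)
      rw [← Real.rpow_mul (by norm_num), one_div_mul_cancel hb0.ne', Real.rpow_one]
    have h3 : p.2 ^ b = p.2 ^ (b - 1) * p.2 := by
      rw [Real.rpow_sub_one h0.ne', div_mul_cancel₀ _ h0.ne']
    rw [h3]
    nlinarith
  have hPa : ∀ k, ∀ p ∈ (P k).disks, p.2 ^ a ≤ p.2 / 2 := fun k p hp =>
    (Real.rpow_le_rpow_of_exponent_ge ((P k).pos p hp)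
      (((P k).le_half p hp).trans (by norm_num)) hba).trans (hPb k p hp)
  refine ⟨packingCantor P a, cantorMap P a K⁻¹, isCompact_packingCantor P a,
    isQuasiconformal_cantorMap P hK ha, hausdorffMeasure_packingCantor_pos P ha.le hPa hP2,
    hausdorffMeasure_packingCantor_lt_top P ha.le, ?_⟩
  rw [hd', cantorMap_image_packingCantor P ha.le hKinv]
  exact ⟨hausdorffMeasure_packingCantor_pos P hb1.le hPb hP2,
    hausdorffMeasure_packingCantor_lt_top P hb1.le⟩

theorem corollary3p4 (K : ℝ) (hK : 1 ≤ K) (d : ℝ) (hd0 : 0 < d) (hd2 : d < 2) :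
    (∃ (E : Set ℂ) (φ : ℂ → ℂ), IsCompact E ∧ IsQuasiconformal K φ ∧
      0 < μH[d] E ∧ μH[d] E < ⊤ ∧
      0 < μH[2 * K * d / (2 + (K - 1) * d)] (φ '' E) ∧
      μH[2 * K * d / (2 + (K - 1) * d)] (φ '' E) < ⊤) ∧
    ∀ g : ℝ → ℝ, IsGauge g → GaugePrec (fun t => t ^ d) g →
      ¬ ∀ (E : Set ℂ) (φ : ℂ → ℂ), IsCompact E → IsQuasiconformal K φ →
        gaugeHausdorff g E = 0 → μH[2 * K * d / (2 + (K - 1) * d)] (φ '' E) = 0 := by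
  obtain ⟨E, φ, hE, hφ, h1, h2, h3, h4⟩ := exists_extremal_pair hK hd0 hd2
  refine ⟨⟨E, φ, hE, hφ, h1, h2, h3, h4⟩, fun g hg hdg h => h3.ne' ?_⟩
  exact h E φ hE hφ (gaugeHausdorff_eq_zero hd0 hg hdg h2.ne)
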